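/- Let $(M,g)$ be a compact, connected, two-dimensional smooth Riemannian manifold without boundary, with Riemannian area measure $\mu$ and Laplace–Beltrami operator $\Delta=\operatorname{div}\nabla$. Let $f:M\to\mathbb R$ be a smooth, not identically zero function with $-\Delta f=\lambda f$ on $M$, and assume that $f$ is a Morse function, i.e. that its Hessian is nondegenerate at every critical point. Let $\varphi(t,x)$ be the flow of $-\nabla f$, and for a critical point $c$ let $W^s(c)=\{y:\lim_{t\to\infty}\varphi(t,y)=c\}$ and $W^u(c)=\{y:\lim_{t\to-\infty}\varphi(t,y)=c\}$. Let $\Omega$ be a Neumann domain of $f$, i.e. a connected component of $W^s(p)\cap W^u(q)$ for some local minimum $p$ and some local maximum $q$ of $f$. Then: 1. $f|_\Omega$ is an eigenfunction with eigenvalue $\lambda$ of the Neumann Laplacian of $\Omega$ (the self-adjoint operator associated with the form $\int_\Omega g(\nabla u,\nabla v)\,d\mu$ on the Sobolev space $H^1(\Omega)$): $f|_\Omega$ is a nonzero element of $H^1(\Omega)$, and $$\int_\Omega g(\nabla f,\nabla v)\,d\mu=\lambda\int_\Omega f\,v\,d\mu\qquad\text{for all }v\in H^1(\Omega).$$ 2.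 The normal derivative of $f$ vanishes on $\partial\Omega$: if $x\in\partial\Omega$ and $h$ is a real function on $M$, differentiable at $x$, that vanishes on $\partial\Omega$ near $x$, then $g(\nabla h,\nabla f)(x)=0$. (In particular $\hat n\cdot\nabla f=0$ wherever $\partial\Omega$ is a $C^1$ curve with unit normal $\hat n$.) -/

import Mathlib

open Set Filter MeasureTheory
open scoped Manifold ContDiff Topology

namespace NeumannDomains

/-- The model plane with its Euclidean norm and Lebesgue measure. -/
abbrev Plane : Type := EuclideanSpace ℝ (Fin 2)

section Metric

variable {M : Type*} [TopologicalSpace M] [ChartedSpace Plane M] [IsManifold (𝓡 2) ∞ M]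

/-- A smooth Riemannian metric on the surface `M`. -/
abbrev Metric (M : Type*) [TopologicalSpace M] [ChartedSpace Plane M]
    [IsManifold (𝓡 2) ∞ M] : Type _ :=
  Bundle.ContMDiffRiemannianMetric (𝓡 2) ∞ Plane (fun x : M => TangentSpace (𝓡 2) x)

/-- A (not necessarily continuous) vector field on `M`. -/
abbrev VField (M : Type*) [TopologicalSpace M] [ChartedSpace Plane M] : Type _ :=
  (x : M) → TangentSpace (𝓡 2) x

/-- Every covector is represented by a tangent vector through the metric. -/
theorem exists_sharp (g : Metric M) (x : M) (l : TangentSpace (𝓡 2) x →L[ℝ] ℝ) :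
    ∃ v : TangentSpace (𝓡 2) x, ∀ w, g.inner x v w = l w := by
  have : FiniteDimensional ℝ (TangentSpace (𝓡 2) x) :=
    inferInstanceAs (FiniteDimensional ℝ Plane)
  let B : TangentSpace (𝓡 2) x →ₗ[ℝ] Module.Dual ℝ (TangentSpace (𝓡 2) x) :=
    { toFun := fun v => (g.inner x v).toLinearMap
      map_add' := fun v w => by ext; simp
      map_smul' := fun c v => by ext; simp }
  have hinj : Function.Injective B := by
    rw [injective_iff_map_eq_zero]
    intro v hv
    by_contra hne
    have h1 : g.inner x v v = 0 := LinearMap.congr_fun hv v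
    exact (g.pos x v hne).ne' h1
  have hsurj : Function.Surjective B :=
    (LinearMap.injective_iff_surjective_of_finrank_eq_finrank
      (Subspace.dual_finrank_eq).symm).1 hinj
  obtain ⟨v, hv⟩ := hsurj l.toLinearMap
  exact ⟨v, fun w => LinearMap.congr_fun hv w⟩

/-- The Riemannian gradient: `g (∇f, w) = df(w)` for every tangent vector `w`. -/
noncomputable def grad (g : Metric M) (f : M → ℝ) : VField M :=
  fun x => Classical.choose (exists_sharp g x (mfderiv (𝓡 2) 𝓘(ℝ, ℝ) f x))

theorem inner_grad (g : Metric M) (f : M → ℝ) (x : M) (w : TangentSpace (𝓡 2) x) :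
    g.inner x (grad g f x) w = mfderiv (𝓡 2) 𝓘(ℝ, ℝ) f x w :=
  Classical.choose_spec (exists_sharp g x (mfderiv (𝓡 2) 𝓘(ℝ, ℝ) f x)) w

/-- The coordinate vector field `∂_i` of the chart centred at `c`, at the point with
coordinates `y`. -/
noncomputable def coordVec (c : M) (y : Plane) (i : Fin 2) :
    TangentSpace (𝓡 2) ((chartAt Plane c).symm y) :=
  mfderiv (𝓡 2) (𝓡 2) (chartAt Plane c).symm y (EuclideanSpace.single i (1 : ℝ) : Plane)

/-- The matrix `g_ij = g(∂_i, ∂_j)` of the metric in the chart centred at `c`. -/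
noncomputable def gram (g : Metric M) (c : M) (y : Plane) : Matrix (Fin 2) (Fin 2) ℝ :=
  Matrix.of fun i j => g.inner ((chartAt Plane c).symm y) (coordVec c y i) (coordVec c y j)

/-- The density `√(det g_ij)` of the Riemannian area in the chart centred at `c`. -/
noncomputable def density (g : Metric M) (c : M) (y : Plane) : ℝ :=
  Real.sqrt (gram g c y).det

/-- The components `(X^1, X^2)` at `x` of a vector field in the chart centred at `c`. -/
noncomputable def components (c : M) (X : VField M) (x : M) : Plane :=
  mfderiv (𝓡 2) (𝓡 2) (chartAt Plane c) x (X x)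

/-- The Riemannian divergence `(1/√det g) ∑ i, ∂_i (√det g X^i)`, computed at `x` in the
chart centred at `x`. -/
noncomputable def divergence (g : Metric M) (X : VField M) (x : M) : ℝ :=
  (density g x (chartAt Plane x x))⁻¹ *
    ∑ i : Fin 2, fderiv ℝ
      (fun y : Plane => density g x y * components x X ((chartAt Plane x).symm y) i)
      (chartAt Plane x x) (EuclideanSpace.single i (1 : ℝ))

/-- The Laplace-Beltrami operator `Δ = div ∇`. -/
noncomputable def laplaceBeltrami (g : Metric M) (f : M → ℝ) : M → ℝ :=
  divergence g (grad g f)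

/-- `f` is an eigenfunction: smooth, not identically zero, and `-Δ f = lam f`. -/
structure IsLaplaceEigenfunction (g : Metric M) (f : M → ℝ) (lam : ℝ) : Prop where
  smooth : ContMDiff (𝓡 2) 𝓘(ℝ, ℝ) ∞ f
  ne_zero : f ≠ 0
  eigen : ∀ x, -laplaceBeltrami g f x = lam * f x

end Metric

section Morse

variable {M : Type*} [TopologicalSpace M] [ChartedSpace Plane M] [IsManifold (𝓡 2) ∞ M]

/-- The Hessian of `f` at `x` in the chart centred at `x`. -/
noncomputable def hessian (f : M → ℝ) (x : M) : Plane →L[ℝ] Plane →L[ℝ] ℝ :=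
  fderiv ℝ (fderiv ℝ (f ∘ (chartAt Plane x).symm)) (chartAt Plane x x)

/-- `f` is a Morse function: smooth, and the Hessian is nondegenerate at each critical point. -/
structure IsMorse (f : M → ℝ) : Prop where
  smooth : ContMDiff (𝓡 2) 𝓘(ℝ, ℝ) ∞ f
  nondegenerate : ∀ x, mfderiv (𝓡 2) 𝓘(ℝ, ℝ) f x = 0 →
    ∀ v, (∀ w, hessian f x v w = 0) → v = 0

/-- `γ` is the flow line `t ↦ φ(t, y)` of `-∇f` that starts at `y`. -/
def IsFlowLine (g : Metric M) (f : M → ℝ) (γ : ℝ → M) (y : M) : Prop :=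
  γ 0 = y ∧ IsMIntegralCurve γ (fun x => -grad g f x : VField M)

/-- The stable manifold `{y | φ(t, y) → x as t → ∞}`. -/
def stableManifold (g : Metric M) (f : M → ℝ) (x : M) : Set M :=
  {y | ∃ γ : ℝ → M, IsFlowLine g f γ y ∧ Tendsto γ atTop (𝓝 x)}

/-- The unstable manifold `{y | φ(t, y) → x as t → -∞}`. -/
def unstableManifold (g : Metric M) (f : M → ℝ) (x : M) : Set M :=
  {y | ∃ γ : ℝ → M, IsFlowLine g f γ y ∧ Tendsto γ atBot (𝓝 x)}

/-- `Ω` is a Neumann domain of `f`: a connected component of `W^s(p) ∩ W^u(q)` for a (local)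
minimum `p` and a (local) maximum `q`. -/
def IsNeumannDomain (g : Metric M) (f : M → ℝ) (Ω : Set M) : Prop :=
  ∃ p q : M, IsLocalMin f p ∧ IsLocalMax f q ∧
    ∃ y ∈ stableManifold g f p ∩ unstableManifold g f q,
      Ω = connectedComponentIn (stableManifold g f p ∩ unstableManifold g f q) y

end Morse

section Volume

theorem exists_chart_cover (M : Type*) [TopologicalSpace M] [ChartedSpace Plane M]
    [CompactSpace M] [Nonempty M] :
    ∃ c : ℕ → M, ⋃ n, (chartAt Plane (c n)).source = univ := by
  obtain ⟨s, hs, hu⟩ := countable_cover_nhds_of_sigmaCompact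
    fun x : M => chart_source_mem_nhds Plane x
  have hne : s.Nonempty := by
    by_contra h
    rw [not_nonempty_iff_eq_empty] at h
    subst h
    simp only [mem_empty_iff_false, iUnion_of_empty, iUnion_empty] at hu
    exact empty_ne_univ hu
  obtain ⟨c, rfl⟩ := hs.exists_eq_range hne
  exact ⟨c, by simpa using hu⟩

variable {M : Type*} [TopologicalSpace M] [ChartedSpace Plane M] [IsManifold (𝓡 2) ∞ M]
  [CompactSpace M] [Nonempty M] [MeasurableSpace M]

/-- The Riemannian area on the domain of the chart centred at `c`: the image of
`√(det g_ij) dy` under the inverse chart. -/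
noncomputable def chartVolume (g : Metric M) (c : M) : Measure M :=
  Measure.map (chartAt Plane c).symm
    (((volume : Measure Plane).restrict (chartAt Plane c).target).withDensity
      fun y => ENNReal.ofReal (density g c y))

/-- The Riemannian area measure, glued from the charts of a countable cover along a partition
of `M` into sets that lie in one chart domain each (the result does not depend on the cover). -/
noncomputable def riemannianVolume (g : Metric M) : Measure M :=
  let c := Classical.choose (exists_chart_cover M)
  Measure.sum fun n => (chartVolume g (c n)).restrict
    (disjointed (fun k => (chartAt Plane (c k)).source) n)

end Volume

section Neumann

variable {M : Type*} [TopologicalSpace M] [ChartedSpace Plane M] [IsManifold (𝓡 2) ∞ M]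
  [CompactSpace M] [Nonempty M] [MeasurableSpace M]

/-- `X` is a continuously differentiable vector field with compact support in `Ω`. -/
def IsTestField (Ω : Set M) (X : VField M) : Prop :=
  ContMDiff (𝓡 2) (𝓡 2).tangent 1 (fun x => (⟨x, X x⟩ : TangentBundle (𝓡 2) M)) ∧
    ∃ K ⊆ Ω, IsCompact K ∧ ∀ x ∉ K, X x = 0

/-- `u` belongs to the Sobolev space `H¹(Ω)` of the open set `Ω` with weak gradient `V`: both are
square integrable on `Ω` (`V` being measurable in charts), and `∫_Ω u div X = -∫_Ω g(V, X)` for all test fields `X`. The values of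
`u` and `V` outside `Ω` are irrelevant. -/
structure IsSobolev (g : Metric M) (Ω : Set M) (u : M → ℝ) (V : VField M) : Prop where
  memLp : MemLp u 2 ((riemannianVolume g).restrict Ω)
  aestronglyMeasurable : ∀ c : M, AEStronglyMeasurable (components c V)
    ((riemannianVolume g).restrict (Ω ∩ (chartAt Plane c).source))
  integrable_sq : Integrable (fun x => g.inner x (V x) (V x)) ((riemannianVolume g).restrict Ω)
  weak_grad : ∀ X : VField M, IsTestField Ω X →
    ∫ x in Ω, u x * divergence g X x ∂(riemannianVolume g) =
      -∫ x in Ω, g.inner x (V x) (X x) ∂(riemannianVolume g)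

/-- The restriction of `u` to the open set `Ω` is an eigenfunction, with eigenvalue `lam`, of the
Neumann Laplacian of `Ω`, the self-adjoint operator of the form `∫_Ω g(∇u, ∇v)` with form domain
`H¹(Ω)`: it is a nonzero element of `H¹(Ω)`, and `∫_Ω g(∇u, ∇v) = lam ∫_Ω u v` for all `v` in
`H¹(Ω)`. -/
def IsNeumannEigenfunction (g : Metric M) (Ω : Set M) (u : M → ℝ) (lam : ℝ) : Prop :=
  ∃ U : VField M, IsSobolev g Ω u U ∧
    ¬ (∀ᵐ x ∂((riemannianVolume g).restrict Ω), u x = 0) ∧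
    ∀ (v : M → ℝ) (V : VField M), IsSobolev g Ω v V →
      ∫ x in Ω, g.inner x (U x) (V x) ∂(riemannianVolume g) =
        lam * ∫ x in Ω, u x * v x ∂(riemannianVolume g)

/-- The normal derivative of `f` vanishes on `∂Ω`: at each boundary point, `∇f` is orthogonal to
the gradient of every function `h` that vanishes on `∂Ω` near that point. Where `∂Ω` is a `C¹`
curve `{h = 0}` with `∇h ≠ 0`, the unit normal is `±∇h / |∇h|`. -/
def NormalDerivativeVanishes (g : Metric M) (Ω : Set M) (f : M → ℝ) : Prop :=
  ∀ x ∈ frontier Ω, ∀ h : M → ℝ, MDifferentiableAt (𝓡 2) 𝓘(ℝ, ℝ) h x →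
    (∀ᶠ y in 𝓝[frontier Ω] x, h y = 0) →
    g.inner x (grad g h x) (grad g f x) = 0

end Neumann

end NeumannDomains

/-! The domain `Ω` is open and is a union of full orbits of the gradient flow, so its complement and
its frontier are flow invariant. Both conclusions follow from this invariance; no regularity of `∂Ω`
is needed, and cusps, or cracks with `Ω` on both sides, do no harm.

Openness: nondegeneracy isolates the critical points (`eventually_mfderiv_ne_zero`), so a local
minimum is strict and attracts a neighbourhood (`exists_trapping_nhds`). Its stable manifold is the
union of the preimages of that neighbourhood under the flow maps, hence open; time reversal handles
the maximum, and components of open sets are open because `M` is locally connected.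

Green's identity: the field `∇f` is not compactly supported in `Ω`, so the weak gradient of `v` is
tested against `a n • ∇f`, where `a n` is a cutoff supported in `Ω` with `a n → 1`. The error is the
integral of `v` times the derivative of `a n` along `∇f`. The full gradient of `a n` may blow up,
but only this one derivative matters, and it can be kept bounded. Indeed, if `d` is the distance to
the complement and `K` a Lipschitz constant of the field, invariance of the complement gives `|∂_F
d| ≤ K d` in the sense of difference quotients; hence a cutoff `θ(d/δ)`, with `θ` constant beyond a
fixed argument, has derivative along the field of size at most a constant times `K`, whatever `δ`
is. Mollifying `d` makes this smooth (`exists_smooth_infDist`, `exists_cutoff`), a partition of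
unity makes it global (`exists_exhaustion`), and dominated convergence removes the error
(`setIntegral_inner_grad`).

Normal derivative: the orbit of a frontier point stays in the frontier, so `h` vanishes along it
near time zero, and differentiating at time zero gives `dh(∇f) = 0`.

The remaining material is calculus on the surface: chart independence of divergence and area, the
divergence theorem, and the global flow of a `C¹` field. -/

namespace NeumannDomains

/-! ### Vector fields, metric and gradient in chart coordinates. -/

section Components

theorem two_le_infty : (2 : WithTop ℕ∞) ≤ ∞ :=
  WithTop.coe_le_coe.2 (le_top : (2 : ℕ∞) ≤ ⊤)

variable {M : Type*} [TopologicalSpace M] [ChartedSpace Plane M] [IsManifold (𝓡 2) ∞ M]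

/-- The vector field `X`, seen as a section of the tangent bundle, is continuously
differentiable. -/
def IsC1Field (X : VField M) : Prop :=
  ContMDiff (𝓡 2) (𝓡 2).tangent 1 (fun x => (⟨x, X x⟩ : TangentBundle (𝓡 2) M))

theorem isManifold_one : IsManifold (𝓡 2) 1 M := .of_le (n := ∞) (by norm_num)

theorem isManifold_two : IsManifold (𝓡 2) (1 + 1) M :=
  .of_le (n := ∞) (one_add_one_eq_two.trans_le two_le_infty)

/-- Links `components` to the trivialization of the tangent bundle, so that smoothness of a section
can be tested on its components. -/
theorem components_eq_trivializationAt (c : M) (X : VField M) {x : M}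
    (hx : x ∈ (chartAt Plane c).source) :
    components c X x = (trivializationAt Plane (TangentSpace (𝓡 2)) c ⟨x, X x⟩).2 := by
  have : IsManifold (𝓡 2) 1 M := isManifold_one
  have key := congrArg (fun l => l (X x))
    (TangentBundle.continuousLinearMapAt_trivializationAt (I := 𝓡 2) hx)
  have h2 : (extChartAt (𝓡 2) c : M → Plane) = chartAt Plane c := by ext; simp
  rw [components, ← h2]
  refine key.symm.trans ?_
  rw [Bundle.Trivialization.continuousLinearMapAt_apply,
    Bundle.Trivialization.linearMapAt_apply, if_pos]
  simpa using hx

theorem contMDiffOn_section_iff_components (c : M) (X : VField M) {a : Set M} (ha : IsOpen a)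
    (hac : a ⊆ (chartAt Plane c).source) :
    ContMDiffOn (𝓡 2) (𝓡 2).tangent 1 (fun x => (⟨x, X x⟩ : TangentBundle (𝓡 2) M)) a ↔
      ContMDiffOn (𝓡 2) 𝓘(ℝ, Plane) 1 (components c X) a := by
  have : IsManifold (𝓡 2) (1 + 1) M := isManifold_two
  have : IsManifold (𝓡 2) 1 M := isManifold_one
  rw [Bundle.Trivialization.contMDiffOn_section_iff
    (trivializationAt Plane (TangentSpace (𝓡 2)) c) ha (by simpa using hac)]
  refine contMDiffOn_congr fun x hx => ?_
  exact (components_eq_trivializationAt c X (hac hx)).symm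

theorem mdifferentiable_chartAt (c : M) :
    (chartAt Plane c).MDifferentiable (𝓡 2) (𝓡 2) := by
  have : IsManifold (𝓡 2) 1 M := isManifold_one
  exact mdifferentiable_chart c

/-- A function on `M`, read in the chart at `c`. -/
theorem contMDiffOn_iff_contDiffOn_chart {E : Type*} [NormedAddCommGroup E] [NormedSpace ℝ E]
    (c : M) (u : M → E) {n : WithTop ℕ∞} (hn : n ≤ ∞) :
    ContMDiffOn (𝓡 2) 𝓘(ℝ, E) n u (chartAt Plane c).source ↔
      ContDiffOn ℝ n (u ∘ (chartAt Plane c).symm) (chartAt Plane c).target := by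
  have : IsManifold (𝓡 2) n M := .of_le (n := ∞) hn
  rw [← contMDiffOn_iff_contDiffOn]
  constructor
  · intro h
    exact h.comp (contMDiffOn_chart_symm (n := n)) fun y hy => (chartAt Plane c).map_target hy
  · intro h
    have := h.comp (contMDiffOn_chart (I := 𝓡 2) (n := n) (x := c))
      fun y hy => (chartAt Plane c).map_source hy
    refine this.congr fun x hx => ?_
    simp [(chartAt Plane c).left_inv hx]

theorem isC1Field_iff (X : VField M) :
    IsC1Field X ↔ ∀ c : M, ContDiffOn ℝ 1 (components c X ∘ (chartAt Plane c).symm)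
      (chartAt Plane c).target := by
  have h1 : (1 : WithTop ℕ∞) ≤ ∞ := by norm_num
  constructor
  · intro h c
    rw [← contMDiffOn_iff_contDiffOn_chart c _ h1,
      ← contMDiffOn_section_iff_components c X (chartAt Plane c).open_source subset_rfl]
    exact h.contMDiffOn
  · intro h x
    have := h x
    rw [← contMDiffOn_iff_contDiffOn_chart x _ h1,
      ← contMDiffOn_section_iff_components x X (chartAt Plane x).open_source subset_rfl] at this
    exact this.contMDiffAt ((chartAt Plane x).open_source.mem_nhds (mem_chart_source _ x))

theorem mfderiv_chart_symm_components (c : M) (X : VField M) {x : M}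
    (hx : x ∈ (chartAt Plane c).source) :
    (mfderiv (𝓡 2) (𝓡 2) (chartAt Plane c).symm (chartAt Plane c x) (components c X x) : Plane)
      = X x := by
  have := (mdifferentiable_chartAt c).symm_comp_deriv hx
  exact congrArg (fun l => l (X x)) this

theorem mfderiv_chart_mfderiv_symm (c : M) {x : M} (hx : x ∈ (chartAt Plane c).source)
    (v : Plane) :
    (mfderiv (𝓡 2) (𝓡 2) (chartAt Plane c) x
      (mfderiv (𝓡 2) (𝓡 2) (chartAt Plane c).symm (chartAt Plane c x) v : Plane) : Plane) = v := by
  have := (mdifferentiable_chartAt c).symm.symm_comp_deriv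
    (x := chartAt Plane c x) ((chartAt Plane c).map_source hx)
  have := congrArg (fun l => l v) this
  simp only [OpenPartialHomeomorph.symm_symm] at this
  have h2 : (chartAt Plane c).symm (chartAt Plane c x) = x := (chartAt Plane c).left_inv hx
  -- The base point occurs in the type of the tangent space, so it is replaced by generalizing it
  -- rather than by rewriting.
  have h3 : ∀ (x' : M), x' = x → ∀ v : Plane,
      (mfderiv (𝓡 2) (𝓡 2) (chartAt Plane c) x' v : Plane) =
        (mfderiv (𝓡 2) (𝓡 2) (chartAt Plane c) x v : Plane) := by
    rintro _ rfl _; rfl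
  exact (h3 _ h2 _).symm.trans this

theorem exists_components_eq (c : M) {x : M} (hx : x ∈ (chartAt Plane c).source) (v : Plane) :
    ∃ X : VField M, components c X x = v :=
  ⟨fun x' => (mfderiv (𝓡 2) (𝓡 2) (chartAt Plane c).symm (chartAt Plane c x') v : Plane),
    mfderiv_chart_mfderiv_symm c hx v⟩

/-- The coordinate field `∂_i` of the chart at `c`. -/
noncomputable def frame (c : M) (i : Fin 2) : VField M :=
  fun x => (coordVec c (chartAt Plane c x) i : Plane)

theorem components_frame (c : M) (i : Fin 2) {x : M} (hx : x ∈ (chartAt Plane c).source) :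
    components c (frame c i) x = EuclideanSpace.single i (1 : ℝ) :=
  mfderiv_chart_mfderiv_symm c hx _

theorem contMDiffOn_frame (c : M) (i : Fin 2) :
    ContMDiffOn (𝓡 2) (𝓡 2).tangent 1
      (fun x => (⟨x, frame c i x⟩ : TangentBundle (𝓡 2) M)) (chartAt Plane c).source := by
  rw [contMDiffOn_section_iff_components c _ (chartAt Plane c).open_source subset_rfl]
  exact contMDiffOn_const.congr fun x hx => components_frame c i hx

theorem plane_eq_sum (v : Plane) : v = ∑ i, v i • EuclideanSpace.single i (1 : ℝ) := by
  ext j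
  fin_cases j <;> simp

theorem eq_sum_frame (c : M) (X : VField M) {x : M} (hx : x ∈ (chartAt Plane c).source) :
    X x = ∑ i, components c X x i • frame c i x := by
  refine (mfderiv_chart_symm_components c X hx).symm.trans ?_
  conv_lhs => rw [plane_eq_sum (components c X x)]
  exact map_sum_smul_aux _ _
where
  map_sum_smul_aux (l : Plane →L[ℝ] Plane) (v : Plane) :
      l (∑ i, v i • EuclideanSpace.single i (1 : ℝ)) =
        ∑ i, v i • l (EuclideanSpace.single i (1 : ℝ)) := by
    simp

theorem gram_chart (g : Metric M) (c : M) {x : M} (hx : x ∈ (chartAt Plane c).source)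
    (i j : Fin 2) :
    gram g c (chartAt Plane c x) i j = g.inner x (frame c i x) (frame c j x) := by
  have h2 : (chartAt Plane c).symm (chartAt Plane c x) = x := (chartAt Plane c).left_inv hx
  have h3 : ∀ (x' : M), x' = x → ∀ v w : Plane,
      g.inner x' (v : Plane) (w : Plane) = g.inner x (v : Plane) (w : Plane) := by
    rintro _ rfl _ _; rfl
  exact h3 _ h2 _ _

theorem inner_eq_sum (g : Metric M) (c : M) (X Y : VField M) {x : M}
    (hx : x ∈ (chartAt Plane c).source) :
    g.inner x (X x) (Y x) = ∑ i, ∑ j, gram g c (chartAt Plane c x) i j *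
      (components c X x i * components c Y x j) := by
  conv_lhs => rw [eq_sum_frame c X hx, eq_sum_frame c Y hx]
  simp only [gram_chart g c hx, Fin.sum_univ_two, map_add, map_smul, add_apply,
    smul_apply, smul_eq_mul]
  ring

theorem contDiffOn_gram (g : Metric M) (c : M) (i j : Fin 2) :
    ContDiffOn ℝ 1 (fun y => gram g c y i j) (chartAt Plane c).target := by
  have : IsManifold (𝓡 2) (1 + 1) M := isManifold_two
  have : IsManifold (𝓡 2) 1 M := isManifold_one
  have h := (g.contMDiff.of_le (m := 1) (by norm_num)).contMDiffOn
    (s := (chartAt Plane c).source)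
  have h2 := h.clm_bundle_apply₂ (F₁ := Plane) (F₂ := Plane) (contMDiffOn_frame c i)
    (contMDiffOn_frame c j)
  have h3 : ContMDiffOn (𝓡 2) 𝓘(ℝ, ℝ) 1 (fun x => g.inner x (frame c i x) (frame c j x))
      (chartAt Plane c).source := fun x hx => by
    simpa using ((Bundle.contMDiffWithinAt_totalSpace).1 (h2 x hx)).2
  rw [contMDiffOn_iff_contDiffOn_chart c _ (by norm_num)] at h3
  refine h3.congr fun y hy => ?_
  have := gram_chart g c ((chartAt Plane c).map_target hy) i j
  rwa [(chartAt Plane c).right_inv hy] at this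

theorem gram_symm (g : Metric M) (c : M) (y : Plane) (i j : Fin 2) :
    gram g c y i j = gram g c y j i := g.symm _ _ _

theorem gram_det_pos (g : Metric M) (c : M) {y : Plane} (hy : y ∈ (chartAt Plane c).target) :
    0 < (gram g c y).det := by
  set x := (chartAt Plane c).symm y with hxdef
  have hx : x ∈ (chartAt Plane c).source := (chartAt Plane c).map_target hy
  have hxy : chartAt Plane c x = y := (chartAt Plane c).right_inv hy
  have hpos : ∀ v : Plane, v ≠ 0 → 0 < ∑ i, ∑ j, gram g c y i j * (v i * v j) := by
    intro v hv
    obtain ⟨X, hXc⟩ := exists_components_eq c hx v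
    have h := inner_eq_sum g c X X hx
    rw [hXc, hxy] at h
    rw [← h]
    refine g.pos x _ fun h0 => hv ?_
    rw [← hXc, components, h0, map_zero]
    rfl
  have h1 := hpos (EuclideanSpace.single 0 1) (by simp)
  -- On this vector the quadratic form equals `g₀₀ · det`, and `g₀₀ > 0` by the previous line.
  have h2 := hpos (!₂[- gram g c y 0 1, gram g c y 0 0]) (by
    intro h
    have h0 := congrArg (fun v : Plane => v 1) h
    simp at h0 h1
    exact h1.ne' h0)
  simp [Fin.sum_univ_two] at h1 h2
  rw [Matrix.det_fin_two]
  rw [gram_symm g c y 1 0] at *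
  nlinarith

theorem density_pos (g : Metric M) (c : M) {y : Plane} (hy : y ∈ (chartAt Plane c).target) :
    0 < density g c y := Real.sqrt_pos.2 (gram_det_pos g c hy)

theorem contDiffOn_gram_det (g : Metric M) (c : M) :
    ContDiffOn ℝ 1 (fun y => (gram g c y).det) (chartAt Plane c).target := by
  simp only [Matrix.det_fin_two]
  exact ((contDiffOn_gram g c 0 0).mul (contDiffOn_gram g c 1 1)).sub
    ((contDiffOn_gram g c 0 1).mul (contDiffOn_gram g c 1 0))

theorem contDiffOn_density (g : Metric M) (c : M) :
    ContDiffOn ℝ 1 (density g c) (chartAt Plane c).target :=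
  (contDiffOn_gram_det g c).sqrt fun _ hy => (gram_det_pos g c hy).ne'

/-- The derivative of a function in terms of its expression in the chart at `c`. -/
theorem mfderiv_eq_fderiv_chart {E : Type*} [NormedAddCommGroup E] [NormedSpace ℝ E]
    (c : M) {u : M → E} {x : M} (hx : x ∈ (chartAt Plane c).source)
    (hu : MDifferentiableAt (𝓡 2) 𝓘(ℝ, E) u x) (X : VField M) :
    (mfderiv (𝓡 2) 𝓘(ℝ, E) u x (X x) : E) =
      fderiv ℝ (u ∘ (chartAt Plane c).symm) (chartAt Plane c x) (components c X x) := by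
  have hl : (chartAt Plane c).symm (chartAt Plane c x) = x := (chartAt Plane c).left_inv hx
  have hd : MDifferentiableAt (𝓡 2) (𝓡 2) (chartAt Plane c).symm (chartAt Plane c x) :=
    (mdifferentiable_chartAt c).mdifferentiableAt_symm ((chartAt Plane c).map_source hx)
  have hu' : MDifferentiableAt (𝓡 2) 𝓘(ℝ, E) u ((chartAt Plane c).symm (chartAt Plane c x)) := by
    rwa [hl]
  have h := mfderiv_comp (chartAt Plane c x) hu' hd
  rw [← mfderiv_eq_fderiv]
  have h3 : ∀ (x' : M), x' = x → ∀ v : Plane,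
      (mfderiv (𝓡 2) 𝓘(ℝ, E) u x' v : E) = (mfderiv (𝓡 2) 𝓘(ℝ, E) u x v : E) := by
    rintro _ rfl _; rfl
  have h4 := congrArg (fun l => l (components c X x)) h
  refine Eq.trans ?_ h4.symm
  refine Eq.trans ?_ (h3 _ hl _).symm
  exact congrArg (fun v : Plane => (mfderiv (𝓡 2) 𝓘(ℝ, E) u x v : E))
    (mfderiv_chart_symm_components c X hx).symm

/-- The components of the gradient solve the linear system `∑ j, g_ij X^j = ∂_i f`; Cramer's rule
writes them as quotients of `C¹` functions with denominator `det g`. -/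
theorem isC1Field_grad (g : Metric M) {f : M → ℝ} (hf : ContMDiff (𝓡 2) 𝓘(ℝ, ℝ) ∞ f) :
    IsC1Field (grad g f) := by
  rw [isC1Field_iff]
  intro c
  set e := chartAt Plane c
  have hfe : ContDiffOn ℝ ∞ (f ∘ e.symm) e.target :=
    (contMDiffOn_iff_contDiffOn_chart c f le_rfl).1 hf.contMDiffOn
  have hb : ∀ i : Fin 2, ContDiffOn ℝ 1
      (fun y => fderiv ℝ (f ∘ e.symm) y (EuclideanSpace.single i (1 : ℝ))) e.target := by
    intro i
    have := hfe.fderiv_of_isOpen e.open_target (m := 1)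
      (one_add_one_eq_two.trans_le two_le_infty)
    exact this.clm_apply contDiffOn_const
  have hlin : ∀ y ∈ e.target, ∀ i : Fin 2,
      fderiv ℝ (f ∘ e.symm) y (EuclideanSpace.single i (1 : ℝ)) =
        gram g c y i 0 * components c (grad g f) (e.symm y) 0 +
        gram g c y i 1 * components c (grad g f) (e.symm y) 1 := by
    intro y hy i
    have hx : e.symm y ∈ e.source := e.map_target hy
    have hxy : e (e.symm y) = y := e.right_inv hy
    have h1 := inner_grad g f (e.symm y) (frame c i (e.symm y))
    rw [mfderiv_eq_fderiv_chart c hx (hf.mdifferentiableAt (by norm_num)) (frame c i),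
      components_frame c i hx, inner_eq_sum g c _ _ hx, components_frame c i hx] at h1
    change _ = fderiv ℝ (f ∘ e.symm) (e (e.symm y)) _ at h1
    change ∑ j, ∑ k, gram g c (e (e.symm y)) j k * _ = _ at h1
    rw [hxy] at h1
    rw [← h1]
    fin_cases i <;> simp [Fin.sum_univ_two, gram_symm g c y 1 0]
  rw [contDiffOn_euclidean]
  have hdet := contDiffOn_gram_det g c
  have h0 : ∀ y ∈ e.target, (gram g c y).det ≠ 0 := fun y hy => (gram_det_pos g c hy).ne'
  intro i
  fin_cases i
  · refine (((hb 0).mul (contDiffOn_gram g c 1 1)).sub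
      ((hb 1).mul (contDiffOn_gram g c 0 1)) |>.div hdet h0).congr fun y hy => ?_
    refine (eq_div_iff (h0 y hy)).2 ?_
    simp only [hlin y hy, Matrix.det_fin_two, Function.comp_apply]
    ring!
  · refine (((hb 1).mul (contDiffOn_gram g c 0 0)).sub
      ((hb 0).mul (contDiffOn_gram g c 1 0)) |>.div hdet h0).congr fun y hy => ?_
    refine (eq_div_iff (h0 y hy)).2 ?_
    simp only [hlin y hy, Matrix.det_fin_two, Function.comp_apply]
    ring!

end Components

/-! ### The Piola identity in the plane. -/

section PlaneCalculus

theorem det_plane (l : Plane →L[ℝ] Plane) :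
    l.det = l (EuclideanSpace.single 0 1) 0 * l (EuclideanSpace.single 1 1) 1 -
      l (EuclideanSpace.single 1 1) 0 * l (EuclideanSpace.single 0 1) 1 := by
  have h := LinearMap.det_toMatrix (EuclideanSpace.basisFun (Fin 2) ℝ).toBasis
    (l : Plane →ₗ[ℝ] Plane)
  rw [ContinuousLinearMap.det, ← h, Matrix.det_fin_two]
  simp [LinearMap.toMatrix_apply]

theorem apply_eq_sum {E : Type*} [NormedAddCommGroup E] [NormedSpace ℝ E] (l : Plane →L[ℝ] E)
    (v : Plane) :
    l v = v 0 • l (EuclideanSpace.single 0 1) + v 1 • l (EuclideanSpace.single 1 1) := by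
  conv_lhs => rw [plane_eq_sum v]
  simp [Fin.sum_univ_two]

/-- The Piola identity in the plane: if `W = s · adj (Dτ) (W' ∘ τ)`, then
`div W = s · det (Dτ) · (div W') ∘ τ`. -/
theorem piola_identity {τ : Plane → Plane} {y : Plane} (hτ : ContDiffAt ℝ 2 τ y)
    {W W' : Fin 2 → Plane → ℝ} (hW' : ∀ i, DifferentiableAt ℝ (W' i) (τ y)) (s : ℝ)
    (h0 : W 0 =ᶠ[𝓝 y] fun z => s * (fderiv ℝ τ z (EuclideanSpace.single 1 1) 1 * W' 0 (τ z) -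
      fderiv ℝ τ z (EuclideanSpace.single 1 1) 0 * W' 1 (τ z)))
    (h1 : W 1 =ᶠ[𝓝 y] fun z => s * (fderiv ℝ τ z (EuclideanSpace.single 0 1) 0 * W' 1 (τ z) -
      fderiv ℝ τ z (EuclideanSpace.single 0 1) 1 * W' 0 (τ z))) :
    ∑ i, fderiv ℝ (W i) y (EuclideanSpace.single i 1) =
      s * (fderiv ℝ τ y).det * ∑ i, fderiv ℝ (W' i) (τ y) (EuclideanSpace.single i 1) := by
  have hτd : DifferentiableAt ℝ τ y := hτ.differentiableAt (by norm_num)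
  have hDd : DifferentiableAt ℝ (fderiv ℝ τ) y :=
    (hτ.fderiv_right (m := 1) (by norm_num)).differentiableAt (by norm_num)
  have hsymm := hτ.isSymmSndFDerivAt (by simp)
  have hJ : ∀ i j : Fin 2, HasFDerivAt (fun z => fderiv ℝ τ z (EuclideanSpace.single i 1) j)
      ((EuclideanSpace.proj j : Plane →L[ℝ] ℝ).comp
        ((ContinuousLinearMap.apply ℝ Plane (EuclideanSpace.single i (1 : ℝ) : Plane)).comp
          (fderiv ℝ (fderiv ℝ τ) y))) y := by
    intro i j
    exact ((EuclideanSpace.proj j : Plane →L[ℝ] ℝ).hasFDerivAt.comp y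
      ((ContinuousLinearMap.apply ℝ Plane
        (EuclideanSpace.single i (1 : ℝ) : Plane)).hasFDerivAt.comp y hDd.hasFDerivAt))
  have hWτ : ∀ i, HasFDerivAt (fun z => W' i (τ z))
      ((fderiv ℝ (W' i) (τ y)).comp (fderiv ℝ τ y)) y :=
    fun i => (hW' i).hasFDerivAt.comp y hτd.hasFDerivAt
  have e0 := (((hJ 1 1).mul (hWτ 0)).sub ((hJ 1 0).mul (hWτ 1))).const_mul s
  have e1 := (((hJ 0 0).mul (hWτ 1)).sub ((hJ 0 1).mul (hWτ 0))).const_mul s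
  have f0 : fderiv ℝ (W 0) y = _ := h0.fderiv_eq.trans e0.fderiv
  have f1 : fderiv ℝ (W 1) y = _ := h1.fderiv_eq.trans e1.fderiv
  -- Symmetry of the second derivative of `τ` makes the rows of the adjugate divergence free; only
  -- derivatives of `W'` survive.
  have hs := hsymm (EuclideanSpace.single 0 1) (EuclideanSpace.single 1 1)
  rw [Fin.sum_univ_two, Fin.sum_univ_two, f0, f1, det_plane]
  simp only [add_apply, sub_apply, smul_apply, ContinuousLinearMap.comp_apply, smul_eq_mul,
    ContinuousLinearMap.apply_apply, PiLp.proj_apply, hs]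
  rw [apply_eq_sum (fderiv ℝ (W' 0) (τ y)) (fderiv ℝ τ y (EuclideanSpace.single 0 1)),
    apply_eq_sum (fderiv ℝ (W' 0) (τ y)) (fderiv ℝ τ y (EuclideanSpace.single 1 1)),
    apply_eq_sum (fderiv ℝ (W' 1) (τ y)) (fderiv ℝ τ y (EuclideanSpace.single 0 1)),
    apply_eq_sum (fderiv ℝ (W' 1) (τ y)) (fderiv ℝ τ y (EuclideanSpace.single 1 1))]
  simp only [smul_eq_mul]
  ring

end PlaneCalculus

/-! ### Transition maps and the transformation of components and density. -/

section Transition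

variable {M : Type*} [TopologicalSpace M] [ChartedSpace Plane M] [IsManifold (𝓡 2) ∞ M]

/-- The transition map from the chart at `c` to the chart at `d`. -/
noncomputable def transition (c d : M) : Plane → Plane :=
  chartAt Plane d ∘ (chartAt Plane c).symm

omit [IsManifold (𝓡 2) ∞ M] in
theorem transition_chart (c d : M) {x : M} (hc : x ∈ (chartAt Plane c).source) :
    transition c d (chartAt Plane c x) = chartAt Plane d x := by
  simp [transition, (chartAt Plane c).left_inv hc]

theorem contDiffAt_transition (c d : M) {x : M} (hc : x ∈ (chartAt Plane c).source)
    (hd : x ∈ (chartAt Plane d).source) :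
    ContDiffAt ℝ ∞ (transition c d) (chartAt Plane c x) := by
  rw [← contMDiffAt_iff_contDiffAt]
  have h1 : ContMDiffAt (𝓡 2) (𝓡 2) ∞ (chartAt Plane c).symm (chartAt Plane c x) :=
    contMDiffOn_chart_symm.contMDiffAt
      ((chartAt Plane c).open_target.mem_nhds ((chartAt Plane c).map_source hc))
  have h2 : ContMDiffAt (𝓡 2) (𝓡 2) ∞ (chartAt Plane d) x :=
    contMDiffOn_chart.contMDiffAt ((chartAt Plane d).open_source.mem_nhds hd)
  refine ContMDiffAt.comp _ ?_ h1
  rwa [(chartAt Plane c).left_inv hc]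

theorem components_transition (c d : M) (X : VField M) {x : M}
    (hc : x ∈ (chartAt Plane c).source) (hd : x ∈ (chartAt Plane d).source) :
    components d X x = fderiv ℝ (transition c d) (chartAt Plane c x) (components c X x) :=
  mfderiv_eq_fderiv_chart c hc ((mdifferentiable_chartAt d).mdifferentiableAt hd) X

theorem det_fderiv_transition_ne_zero (c d : M) {x : M}
    (hc : x ∈ (chartAt Plane c).source) (hd : x ∈ (chartAt Plane d).source) :
    (fderiv ℝ (transition c d) (chartAt Plane c x)).det ≠ 0 := by
  intro h0
  have hdet : LinearMap.det (fderiv ℝ (transition c d) (chartAt Plane c x) : Plane →ₗ[ℝ] Plane) = 0 :=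
    h0
  have hbot := LinearMap.bot_lt_ker_of_det_eq_zero hdet
  obtain ⟨v, hv, hv0⟩ := (Submodule.ne_bot_iff _).1 hbot.ne'
  obtain ⟨X, hXc⟩ := exists_components_eq c hc v
  have h1 := components_transition c d X hc hd
  have h2 := components_transition d c X hd hc
  rw [h1, hXc] at h2
  apply hv0
  rw [h2]
  have : fderiv ℝ (transition c d) (chartAt Plane c x) v = 0 := hv
  rw [this, map_zero]

theorem density_transition (g : Metric M) (c d : M) {x : M}
    (hc : x ∈ (chartAt Plane c).source) (hd : x ∈ (chartAt Plane d).source) :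
    density g c (chartAt Plane c x) =
      |(fderiv ℝ (transition c d) (chartAt Plane c x)).det| * density g d (chartAt Plane d x) := by
  have hg : ∀ i j, gram g c (chartAt Plane c x) i j = ∑ k, ∑ l, gram g d (chartAt Plane d x) k l *
      (fderiv ℝ (transition c d) (chartAt Plane c x) (EuclideanSpace.single i 1) k *
        fderiv ℝ (transition c d) (chartAt Plane c x) (EuclideanSpace.single j 1) l) := by
    intro i j
    rw [gram_chart g c hc, inner_eq_sum g d _ _ hd, components_transition c d _ hc hd,
      components_transition c d _ hc hd, components_frame c i hc, components_frame c j hc]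
  have hdet : (gram g c (chartAt Plane c x)).det =
      (fderiv ℝ (transition c d) (chartAt Plane c x)).det ^ 2 *
        (gram g d (chartAt Plane d x)).det := by
    rw [Matrix.det_fin_two, Matrix.det_fin_two, det_plane, hg, hg, hg, hg]
    simp only [Fin.sum_univ_two]
    ring
  rw [density, density, hdet, Real.sqrt_mul (sq_nonneg _), Real.sqrt_sq_eq_abs]

end Transition

/-! ### Chart independence of the divergence and the product rule. -/

section Divergence

variable {M : Type*} [TopologicalSpace M] [ChartedSpace Plane M] [IsManifold (𝓡 2) ∞ M]

/-- The components of the vector density `√(det g) X` in the chart at `c`. -/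
noncomputable def vectorDensity (g : Metric M) (c : M) (X : VField M) (i : Fin 2) (y : Plane) : ℝ :=
  density g c y * components c X ((chartAt Plane c).symm y) i

theorem contDiffOn_vectorDensity (g : Metric M) (c : M) {X : VField M} (hX : IsC1Field X)
    (i : Fin 2) : ContDiffOn ℝ 1 (vectorDensity g c X i) (chartAt Plane c).target :=
  (contDiffOn_density g c).mul (contDiffOn_euclidean.1 ((isC1Field_iff X).1 hX c) i)

theorem differentiableAt_vectorDensity (g : Metric M) (c : M) {X : VField M} (hX : IsC1Field X)
    (i : Fin 2) {x : M} (hx : x ∈ (chartAt Plane c).source) :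
    DifferentiableAt ℝ (vectorDensity g c X i) (chartAt Plane c x) :=
  ((contDiffOn_vectorDensity g c hX i).contDiffAt ((chartAt Plane c).open_target.mem_nhds
    ((chartAt Plane c).map_source hx))).differentiableAt (by norm_num)

/-- The divergence computed in the chart at `c`. -/
noncomputable def divergenceIn (g : Metric M) (c : M) (X : VField M) (x : M) : ℝ :=
  (density g c (chartAt Plane c x))⁻¹ *
    ∑ i : Fin 2, fderiv ℝ (vectorDensity g c X i) (chartAt Plane c x) (EuclideanSpace.single i 1)

/-- Components transform by `Dτ` and the density by `|det Dτ|`, so the vector density `√(det g) X`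
satisfies the hypothesis of `piola_identity`; the determinant it produces cancels against the change
of density. -/
theorem divergenceIn_eq (g : Metric M) {X : VField M} (hX : IsC1Field X) (c d : M) {x : M}
    (hc : x ∈ (chartAt Plane c).source) (hd : x ∈ (chartAt Plane d).source) :
    divergenceIn g c X x = divergenceIn g d X x := by
  set τ := transition c d with hτ
  set y := chartAt Plane c x with hy
  have hτy : τ y = chartAt Plane d x := transition_chart c d hc
  set D := fun z => (fderiv ℝ τ z).det with hD
  have hsm : ContDiffAt ℝ ∞ τ y := contDiffAt_transition c d hc hd
  have hDc : ContinuousAt D y :=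
    ContinuousLinearMap.continuous_det.continuousAt.comp
      (hsm.fderiv_right (m := 1) (one_add_one_eq_two.trans_le two_le_infty)).continuousAt
  have hD0 : D y ≠ 0 := det_fderiv_transition_ne_zero c d hc hd
  -- The Piola identity involves `det Dτ`, the density its absolute value; `s = ±1` is the sign,
  -- which is constant near `y`.
  obtain ⟨s, hs1, hs⟩ : ∃ s : ℝ, s * s = 1 ∧ ∀ᶠ z in 𝓝 y, |D z| = s * D z := by
    rcases lt_or_gt_of_ne hD0 with h | h
    · exact ⟨-1, by norm_num, (hDc.eventually (gt_mem_nhds h)).mono fun z hz => by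
        rw [abs_of_neg hz]; ring⟩
    · exact ⟨1, by norm_num, (hDc.eventually (lt_mem_nhds h)).mono fun z hz => by
        rw [abs_of_pos hz]; ring⟩
  have hnear : ∀ᶠ z in 𝓝 y, ∃ x' ∈ (chartAt Plane c).source,
      x' ∈ (chartAt Plane d).source ∧ chartAt Plane c x' = z := by
    have h1 : (chartAt Plane c).target ∈ 𝓝 y :=
      (chartAt Plane c).open_target.mem_nhds ((chartAt Plane c).map_source hc)
    have h2 : ContinuousAt (chartAt Plane c).symm y :=
      (chartAt Plane c).continuousAt_symm ((chartAt Plane c).map_source hc)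
    have h3 : (chartAt Plane d).source ∈ 𝓝 ((chartAt Plane c).symm y) := by
      rw [hy, (chartAt Plane c).left_inv hc]
      exact (chartAt Plane d).open_source.mem_nhds hd
    filter_upwards [h1, h2 h3] with z hz1 hz2
    exact ⟨(chartAt Plane c).symm z, (chartAt Plane c).map_target hz1, hz2,
      (chartAt Plane c).right_inv hz1⟩
  have hW : ∀ᶠ z in 𝓝 y, D z ≠ 0 ∧ ∀ i, s * D z * vectorDensity g d X i (τ z) =
      vectorDensity g c X 0 z * fderiv ℝ τ z (EuclideanSpace.single 0 1) i +
      vectorDensity g c X 1 z * fderiv ℝ τ z (EuclideanSpace.single 1 1) i := by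
    filter_upwards [hnear, hs] with z ⟨x', hx'c, hx'd, hz⟩ hsz
    refine ⟨?_, fun i => ?_⟩
    · rw [← hz]; exact det_fderiv_transition_ne_zero c d hx'c hx'd
    have e1 : τ z = chartAt Plane d x' := by rw [← hz]; exact transition_chart c d hx'c
    have e2 : (chartAt Plane d).symm (τ z) = x' := by
      rw [e1, (chartAt Plane d).left_inv hx'd]
    have e3 : (chartAt Plane c).symm z = x' := by rw [← hz, (chartAt Plane c).left_inv hx'c]
    have e4 := density_transition g c d hx'c hx'd
    rw [← e1, hz] at e4
    change density g c z = |D z| * _ at e4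
    have e5 := components_transition c d X hx'c hx'd
    rw [hz] at e5
    simp only [vectorDensity, e2, e3]
    rw [e5, apply_eq_sum, e4, hsz]
    simp only [PiLp.add_apply, PiLp.smul_apply, smul_eq_mul]
    ring
  have key := piola_identity (τ := τ) (y := y) (W := vectorDensity g c X)
    (W' := vectorDensity g d X) (hsm.of_le two_le_infty) (fun i => by
      rw [hτy]; exact differentiableAt_vectorDensity g d hX i hd) s
    (by
      filter_upwards [hW] with z ⟨hz0, hz⟩
      have a0 := hz 0
      have a1 := hz 1
      have hdz : D z = _ := det_plane (fderiv ℝ τ z)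
      refine mul_left_cancel₀ hz0 ?_
      linear_combination vectorDensity g c X 0 z * hdz
        - fderiv ℝ τ z (EuclideanSpace.single 1 1) 1 * a0
        + fderiv ℝ τ z (EuclideanSpace.single 1 1) 0 * a1)
    (by
      filter_upwards [hW] with z ⟨hz0, hz⟩
      have a0 := hz 0
      have a1 := hz 1
      have hdz : D z = _ := det_plane (fderiv ℝ τ z)
      refine mul_left_cancel₀ hz0 ?_
      linear_combination vectorDensity g c X 1 z * hdz
        - fderiv ℝ τ z (EuclideanSpace.single 0 1) 0 * a1
        + fderiv ℝ τ z (EuclideanSpace.single 0 1) 1 * a0)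
  have e4 := density_transition g c d hc hd
  have hpos : 0 < density g d (chartAt Plane d x) :=
    density_pos g d ((chartAt Plane d).map_source hd)
  change density g c y = |D y| * _ at e4
  rw [divergenceIn, divergenceIn, ← hy, key, e4, hs.self_of_nhds, hτy]
  change _ * (s * D y * _) = _
  have hs0 : s ≠ 0 := by rintro rfl; norm_num at hs1
  field_simp

theorem divergence_eq_divergenceIn (g : Metric M) {X : VField M} (hX : IsC1Field X) (c : M) {x : M}
    (hc : x ∈ (chartAt Plane c).source) : divergence g X x = divergenceIn g c X x :=
  divergenceIn_eq g hX x c (mem_chart_source _ x) hc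

/-- By definition the chart changes with the point; chart independence allows one fixed chart near
`c`. -/
theorem continuous_divergence (g : Metric M) {X : VField M} (hX : IsC1Field X) :
    Continuous (divergence g X) := by
  refine continuous_iff_continuousAt.2 fun c => ?_
  have hmem := (chartAt Plane c).open_source.mem_nhds (mem_chart_source Plane c)
  have hev : divergence g X =ᶠ[𝓝 c] divergenceIn g c X :=
    Filter.eventually_of_mem hmem fun x hx => divergence_eq_divergenceIn g hX c hx
  refine ContinuousAt.congr ?_ hev.symm
  have hce : ContinuousAt (chartAt Plane c) c :=
    (chartAt Plane c).continuousAt (mem_chart_source Plane c)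
  have ht : (chartAt Plane c).target ∈ 𝓝 (chartAt Plane c c) :=
    (chartAt Plane c).open_target.mem_nhds (mem_chart_target Plane c)
  refine ContinuousAt.mul (ContinuousAt.inv₀ ?_ (density_pos g c (mem_chart_target Plane c)).ne') ?_
  · exact ((contDiffOn_density g c).continuousOn.continuousAt ht).comp hce
  · refine tendsto_finsetSum _ fun i _ => ?_
    have h1 := ((contDiffOn_vectorDensity g c hX i).continuousOn_fderiv_of_isOpen
      (chartAt Plane c).open_target le_rfl).continuousAt ht
    exact (h1.comp hce).clm_apply continuousAt_const

omit [IsManifold (𝓡 2) ∞ M] in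
theorem components_smul (c : M) (a : M → ℝ) (X : VField M) (x : M) :
    components c (fun z => a z • X z) x = a x • components c X x :=
  map_smul (mfderiv (𝓡 2) (𝓡 2) (chartAt Plane c) x) _ _

/-- The derivative of the function `a` along the vector field `X`. -/
noncomputable def dirDeriv (a : M → ℝ) (X : VField M) (x : M) : ℝ :=
  mfderiv (𝓡 2) 𝓘(ℝ, ℝ) a x (X x)

theorem divergence_smul (g : Metric M) {X : VField M} (hX : IsC1Field X) {a : M → ℝ} {x : M}
    (ha : MDifferentiableAt (𝓡 2) 𝓘(ℝ, ℝ) a x) :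
    divergence g (fun z => a z • X z) x =
      a x * divergence g X x + dirDeriv a X x := by
  have hx := mem_chart_source Plane x
  set y := chartAt Plane x x with hy
  have hl : (chartAt Plane x).symm y = x := (chartAt Plane x).left_inv hx
  have had : DifferentiableAt ℝ (a ∘ (chartAt Plane x).symm) y := by
    rw [← mdifferentiableAt_iff_differentiableAt]
    refine MDifferentiableAt.comp _ (by rwa [hl]) ?_
    exact (mdifferentiable_chartAt x).mdifferentiableAt_symm ((chartAt Plane x).map_source hx)
  have hd := fun i => differentiableAt_vectorDensity g x hX i hx
  have hfun : ∀ i, vectorDensity g x (fun z => a z • X z) i =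
      fun z => (a ∘ (chartAt Plane x).symm) z * vectorDensity g x X i z := by
    intro i
    ext z
    simp only [vectorDensity, components_smul, PiLp.smul_apply, smul_eq_mul, Function.comp_apply]
    ring
  have hpos : 0 < density g x y := density_pos g x ((chartAt Plane x).map_source hx)
  change divergenceIn g x _ x = a x * divergenceIn g x X x + _
  rw [dirDeriv, mfderiv_eq_fderiv_chart x hx ha X, apply_eq_sum]
  simp only [divergenceIn, hfun, Fin.sum_univ_two, ← hy]
  rw [fderiv_fun_mul had (hd 0), fderiv_fun_mul had (hd 1)]
  simp only [add_apply, smul_apply, smul_eq_mul, vectorDensity, Function.comp_apply, hl]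
  field_simp
  ring

theorem divergence_eq_zero_of_notMem (g : Metric M) {X : VField M} {K : Set M} (hK : IsClosed K)
    (hXK : ∀ x ∉ K, X x = 0) {x : M} (hx : x ∉ K) : divergence g X x = 0 := by
  have hev : ∀ᶠ z in 𝓝 (chartAt Plane x x), (chartAt Plane x).symm z ∉ K := by
    have h2 : ContinuousAt (chartAt Plane x).symm (chartAt Plane x x) :=
      (chartAt Plane x).continuousAt_symm (mem_chart_target Plane x)
    refine h2.eventually (hK.isOpen_compl.mem_nhds ?_)
    rwa [(chartAt Plane x).left_inv (mem_chart_source Plane x)]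
  have hzero : ∀ i, vectorDensity g x X i =ᶠ[𝓝 (chartAt Plane x x)] fun _ => 0 := by
    intro i
    filter_upwards [hev] with z hz
    rw [vectorDensity, components, hXK _ hz, map_zero]
    exact mul_zero _
  change divergenceIn g x X x = 0
  simp [divergenceIn, (hzero _).fderiv_eq]

end Divergence

/-! ### The Riemannian area measure and integration in one chart. -/

section ChartVolume

variable {M : Type*} [TopologicalSpace M] [ChartedSpace Plane M] [IsManifold (𝓡 2) ∞ M]
  [MeasurableSpace M] [BorelSpace M]

omit [IsManifold (𝓡 2) ∞ M] [MeasurableSpace M] [BorelSpace M] in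
theorem measurableSet_target (c : M) : MeasurableSet (chartAt Plane c).target :=
  (chartAt Plane c).open_target.measurableSet

theorem aemeasurable_density (g : Metric M) (c : M) :
    AEMeasurable (fun y => ENNReal.ofReal (density g c y))
      ((volume : Measure Plane).restrict (chartAt Plane c).target) :=
  ((contDiffOn_density g c).continuousOn.aemeasurable (measurableSet_target c)).ennreal_ofReal

theorem aemeasurable_chart_symm (g : Metric M) (c : M) :
    AEMeasurable (chartAt Plane c).symm
      (((volume : Measure Plane).restrict (chartAt Plane c).target).withDensity
        fun y => ENNReal.ofReal (density g c y)) :=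
  ((chartAt Plane c).continuousOn_symm.aemeasurable (measurableSet_target c)).mono_ac
    (withDensity_absolutelyContinuous _ _)

variable [CompactSpace M] [Nonempty M]

omit [IsManifold (𝓡 2) ∞ M] [CompactSpace M] [Nonempty M] in
theorem measurableSet_image_chart (c : M) {A : Set M} (hA : MeasurableSet A)
    (hAc : A ⊆ (chartAt Plane c).source) : MeasurableSet (chartAt Plane c '' A) := by
  obtain ⟨B, hB, hBA⟩ := (measurable_restrict_symm c) hA
  have : chartAt Plane c '' A = B ∩ (chartAt Plane c).target := by
    ext y
    constructor
    · rintro ⟨x, hx, rfl⟩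
      have ht := (chartAt Plane c).map_source (hAc hx)
      refine ⟨?_, ht⟩
      have : (⟨chartAt Plane c x, ht⟩ : (chartAt Plane c).target) ∈ Subtype.val ⁻¹' B := by
        rw [hBA]
        change (chartAt Plane c).symm (chartAt Plane c x) ∈ A
        rwa [(chartAt Plane c).left_inv (hAc hx)]
      exact this
    · rintro ⟨hyB, hyt⟩
      have : (⟨y, hyt⟩ : (chartAt Plane c).target) ∈ Subtype.val ⁻¹' B := hyB
      rw [hBA] at this
      exact ⟨_, this, (chartAt Plane c).right_inv hyt⟩
  rw [this]
  exact hB.inter (measurableSet_target c)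
where
  measurable_restrict_symm (c : M) : Measurable ((chartAt Plane c).target.domRestrict
      (chartAt Plane c).symm) :=
    (continuousOn_iff_continuous_domRestrict.1 (chartAt Plane c).continuousOn_symm).measurable

theorem chartVolume_apply (g : Metric M) (c : M) {A : Set M} (hA : MeasurableSet A)
    (hAc : A ⊆ (chartAt Plane c).source) :
    chartVolume g c A = ∫⁻ y in chartAt Plane c '' A, ENNReal.ofReal (density g c y) := by
  rw [chartVolume, Measure.map_apply_of_aemeasurable (aemeasurable_chart_symm g c) hA]
  have hm := measurableSet_image_chart c hA hAc
  have him : chartAt Plane c '' A = (chartAt Plane c).target ∩ (chartAt Plane c).symm ⁻¹' A :=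
    (chartAt Plane c).toPartialEquiv.image_eq_target_inter_inv_preimage hAc
  rw [withDensity_apply' _ _, Measure.restrict_restrict₀', him, inter_comm]
  exact (measurableSet_target c).nullMeasurableSet

omit [CompactSpace M] [Nonempty M] in
theorem chartVolume_compl_source (g : Metric M) (c : M) :
    chartVolume g c (chartAt Plane c).sourceᶜ = 0 := by
  have hms : MeasurableSet (chartAt Plane c).sourceᶜ :=
    (chartAt Plane c).open_source.measurableSet.compl
  rw [chartVolume, Measure.map_apply_of_aemeasurable (aemeasurable_chart_symm g c) hms]
  refine withDensity_absolutelyContinuous _ _ ?_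
  rw [Measure.restrict_apply' (measurableSet_target c)]
  convert measure_empty (μ := (volume : Measure Plane))
  ext y
  simp only [mem_inter_iff, mem_preimage, mem_compl_iff, mem_empty_iff_false, iff_false, not_and]
  exact fun h hy => h ((chartAt Plane c).map_target hy)

theorem chartVolume_eq (g : Metric M) (c d : M) {A : Set M} (hA : MeasurableSet A)
    (hAc : A ⊆ (chartAt Plane c).source) (hAd : A ⊆ (chartAt Plane d).source) :
    chartVolume g c A = chartVolume g d A := by
  rw [chartVolume_apply g c hA hAc, chartVolume_apply g d hA hAd]
  have himg : chartAt Plane d '' A = transition c d '' (chartAt Plane c '' A) := by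
    rw [image_image]
    exact image_congr fun x hx => (transition_chart c d (hAc hx)).symm
  have hinj : InjOn (transition c d) (chartAt Plane c '' A) := by
    rintro _ ⟨x, hx, rfl⟩ _ ⟨x', hx', rfl⟩ h
    rw [transition_chart c d (hAc hx), transition_chart c d (hAc hx')] at h
    rw [(chartAt Plane d).injOn (hAd hx) (hAd hx') h]
  rw [himg, lintegral_image_eq_lintegral_abs_det_fderiv_mul volume
    (measurableSet_image_chart c hA hAc) (f' := fderiv ℝ (transition c d)) ?_ hinj]
  · refine setLIntegral_congr_fun (measurableSet_image_chart c hA hAc) ?_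
    rintro _ ⟨x, hx, rfl⟩
    simp only
    rw [density_transition g c d (hAc hx) (hAd hx), transition_chart c d (hAc hx),
      ENNReal.ofReal_mul (abs_nonneg _)]
  · rintro _ ⟨x, hx, rfl⟩
    exact ((contDiffAt_transition c d (hAc hx) (hAd hx)).differentiableAt
      (by norm_num)).hasFDerivAt.hasFDerivWithinAt

/-- Chart measures agree on overlaps by change of variables, so the disjoint pieces of the chosen
cover reassemble to the measure of any single chart. -/
theorem riemannianVolume_apply (g : Metric M) (c : M) {A : Set M} (hA : MeasurableSet A)
    (hAc : A ⊆ (chartAt Plane c).source) : riemannianVolume g A = chartVolume g c A := by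
  set d := Classical.choose (exists_chart_cover M) with hd
  have hcover : ⋃ n, (chartAt Plane (d n)).source = univ :=
    Classical.choose_spec (exists_chart_cover M)
  set D := disjointed (fun k => (chartAt Plane (d k)).source) with hD
  have hDm : ∀ n, MeasurableSet (D n) :=
    fun n => MeasurableSet.disjointed (fun k => (chartAt Plane (d k)).open_source.measurableSet) n
  have hDs : ∀ n, D n ⊆ (chartAt Plane (d n)).source := disjointed_subset _
  have hDu : ⋃ n, D n = univ := by rw [hD, iUnion_disjointed, hcover]
  have hDd : Pairwise (Function.onFun Disjoint D) := disjoint_disjointed _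
  change (Measure.sum fun n => (chartVolume g (d n)).restrict (D n)) A = _
  rw [Measure.sum_apply _ hA]
  have h1 : ∀ n, (chartVolume g (d n)).restrict (D n) A = chartVolume g c (A ∩ D n) := by
    intro n
    rw [Measure.restrict_apply hA]
    exact chartVolume_eq g _ _ (hA.inter (hDm n)) (inter_subset_right.trans (hDs n))
      (inter_subset_left.trans hAc)
  simp only [h1]
  rw [← measure_iUnion, ← inter_iUnion, hDu, inter_univ]
  · exact fun i j hij => (hDd hij).mono inter_subset_right inter_subset_right
  · exact fun n => hA.inter (hDm n)

theorem riemannianVolume_restrict_source (g : Metric M) (c : M) :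
    (riemannianVolume g).restrict (chartAt Plane c).source = chartVolume g c := by
  ext A hA
  have hs : MeasurableSet (chartAt Plane c).source := (chartAt Plane c).open_source.measurableSet
  rw [Measure.restrict_apply hA, riemannianVolume_apply g c (hA.inter hs) inter_subset_right]
  refine measure_congr ?_
  refine inter_ae_eq_left_of_ae_eq_univ ?_
  rw [ae_eq_univ]
  exact chartVolume_compl_source g c

instance isFiniteMeasure_riemannianVolume (g : Metric M) :
    IsFiniteMeasure (riemannianVolume g) := by
  have hloc : ∀ x : M, ∃ s ∈ 𝓝 x, riemannianVolume g s < ⊤ := by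
    intro x
    set e := chartAt Plane x
    obtain ⟨r, hr, hrt⟩ := Metric.nhds_basis_closedBall.mem_iff.1
      (e.open_target.mem_nhds (mem_chart_target Plane x))
    have hcont : ContinuousOn (density g x) (Metric.closedBall (e x) r) :=
      (contDiffOn_density g x).continuousOn.mono hrt
    obtain ⟨C, hC⟩ := (isCompact_closedBall (e x) r).exists_bound_of_continuousOn hcont
    refine ⟨e.source ∩ e ⁻¹' Metric.ball (e x) r, ?_, ?_⟩
    · exact (e.isOpen_inter_preimage Metric.isOpen_ball).mem_nhds
        ⟨mem_chart_source Plane x, Metric.mem_ball_self hr⟩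
    · have hms : MeasurableSet (e.source ∩ e ⁻¹' Metric.ball (e x) r) :=
        (e.isOpen_inter_preimage Metric.isOpen_ball).measurableSet
      rw [riemannianVolume_apply g x hms inter_subset_left,
        chartVolume_apply g x hms inter_subset_left]
      have hsub : e '' (e.source ∩ e ⁻¹' Metric.ball (e x) r) ⊆ Metric.closedBall (e x) r := by
        rintro _ ⟨z, hz, rfl⟩
        exact Metric.ball_subset_closedBall hz.2
      calc ∫⁻ y in e '' (e.source ∩ e ⁻¹' Metric.ball (e x) r), ENNReal.ofReal (density g x y)
          ≤ ∫⁻ y in Metric.closedBall (e x) r, ENNReal.ofReal (density g x y) :=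
            lintegral_mono_set hsub
        _ ≤ ∫⁻ y in Metric.closedBall (e x) r, ENNReal.ofReal C :=
            setLIntegral_mono measurable_const fun y hy =>
              ENNReal.ofReal_le_ofReal ((le_abs_self _).trans (hC y hy))
        _ < ⊤ := by
            rw [setLIntegral_const]
            exact ENNReal.mul_lt_top ENNReal.ofReal_lt_top
              (isCompact_closedBall (e x) r).measure_lt_top
  choose s hs hs' using hloc
  obtain ⟨t, ht⟩ := isCompact_univ.elim_nhds_subcover s fun x _ => hs x
  refine ⟨(measure_mono ht.2).trans_lt ?_⟩
  exact (measure_biUnion_finset_le t s).trans_lt (ENNReal.sum_lt_top.2 fun x _ => hs' x)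

/-- Needed so that a continuous function that is nonzero at one point of `Ω` is nonzero in `L²(Ω)`.
-/
instance isOpenPosMeasure_riemannianVolume (g : Metric M) :
    (riemannianVolume g).IsOpenPosMeasure := by
  refine ⟨fun U hU ⟨x, hx⟩ h0 => ?_⟩
  set e := chartAt Plane x
  have hVo : IsOpen (U ∩ e.source) := hU.inter e.open_source
  have hV0 : riemannianVolume g (U ∩ e.source) = 0 := measure_mono_null inter_subset_left h0
  rw [riemannianVolume_apply g x hVo.measurableSet inter_subset_right,
    chartVolume_apply g x hVo.measurableSet inter_subset_right] at hV0
  have himo : IsOpen (e '' (U ∩ e.source)) := e.isOpen_image_of_subset_source hVo inter_subset_right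
  have hsub : e '' (U ∩ e.source) ⊆ e.target := by
    rintro _ ⟨z, hz, rfl⟩
    exact e.map_source hz.2
  rw [setLIntegral_eq_zero_iff' himo.measurableSet] at hV0
  · have : ∀ᵐ y ∂(volume : Measure Plane), y ∉ e '' (U ∩ e.source) := by
      filter_upwards [hV0] with y hy hmem
      have := hy hmem
      rw [ENNReal.ofReal_eq_zero] at this
      exact this.not_gt (density_pos g x (hsub hmem))
    have h3 : (volume : Measure Plane) (e '' (U ∩ e.source)) = 0 :=
      measure_eq_zero_iff_ae_notMem.2 this
    exact himo.measure_ne_zero volume ⟨e x, x, ⟨hx, mem_chart_source Plane x⟩, rfl⟩ h3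
  · exact (aemeasurable_density g x).mono_measure (Measure.restrict_mono hsub le_rfl)

theorem integral_eq_integral_chart (g : Metric M) (c : M) {h : M → ℝ} (hh : Continuous h)
    (hsupp : ∀ x ∉ (chartAt Plane c).source, h x = 0) :
    ∫ x, h x ∂(riemannianVolume g) = ∫ y in (chartAt Plane c).target,
      density g c y * h ((chartAt Plane c).symm y) := by
  rw [← setIntegral_eq_integral_of_forall_compl_eq_zero hsupp, riemannianVolume_restrict_source,
    chartVolume, integral_map (aemeasurable_chart_symm g c) hh.aestronglyMeasurable,
    integral_withDensity_eq_integral_toReal_smul₀ (aemeasurable_density g c)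
      (Eventually.of_forall fun _ => ENNReal.ofReal_lt_top)]
  refine setIntegral_congr_fun (measurableSet_target c) fun y hy => ?_
  simp only [smul_eq_mul, ENNReal.toReal_ofReal (density_pos g c hy).le]

theorem integral_fderiv_eq_zero {w : Plane → ℝ} (hw : ContDiff ℝ 1 w) (hc : HasCompactSupport w)
    (v : Plane) : ∫ y, fderiv ℝ w y v = 0 := by
  have hcont : Continuous fun y => fderiv ℝ w y v :=
    (hw.continuous_fderiv (by norm_num)).clm_apply continuous_const
  have h := integral_mul_fderiv_eq_neg_fderiv_mul_of_integrable (μ := (volume : Measure Plane))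
    (f := fun _ => (1 : ℝ)) (g := w) (v := v) (by simp)
    (by simpa using hcont.integrable_of_hasCompactSupport (hc.fderiv_apply ℝ v))
    (by simpa using hw.continuous.integrable_of_hasCompactSupport hc) (by simp)
    (fun x _ => hw.differentiable (by norm_num) x)
  simpa using h

/-- In the chart the area density cancels the factor `1/√(det g)` of the divergence. What remains is
the Euclidean divergence of a compactly supported field, whose extension by zero is still `C¹`. -/
theorem integral_divergence_of_subset_source [T2Space M] (g : Metric M) (c : M) {X : VField M}
    (hX : IsC1Field X) {K : Set M} (hK : IsCompact K) (hKc : K ⊆ (chartAt Plane c).source)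
    (hXK : ∀ x ∉ K, X x = 0) : ∫ x, divergence g X x ∂(riemannianVolume g) = 0 := by
  set e := chartAt Plane c
  have hdiv0 : ∀ x ∉ K, divergence g X x = 0 := fun x hx =>
    divergence_eq_zero_of_notMem g hK.isClosed hXK hx
  rw [integral_eq_integral_chart g c (continuous_divergence g hX)
    fun x hx => hdiv0 x fun hxK => hx (hKc hxK)]
  have hKt : e '' K ⊆ e.target := by
    rintro _ ⟨x, hx, rfl⟩
    exact e.map_source (hKc hx)
  have hKcomp : IsCompact (e '' K) := hK.image_of_continuousOn (e.continuousOn.mono hKc)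
  set w : Fin 2 → Plane → ℝ := fun i => e.target.indicator (vectorDensity g c X i) with hwdef
  have hw0 : ∀ i, ∀ y ∉ e '' K, w i y = 0 := by
    intro i y hy
    by_cases hyt : y ∈ e.target
    · rw [hwdef]
      simp only [indicator_of_mem hyt]
      rw [vectorDensity, components, hXK _ fun hmem => hy ⟨_, hmem, e.right_inv hyt⟩, map_zero]
      exact mul_zero _
    · exact indicator_of_notMem hyt _
  have hwc : ∀ i, HasCompactSupport (w i) := fun i =>
    HasCompactSupport.intro hKcomp fun y hy => hw0 i y hy
  have hweq : ∀ i, ∀ y ∈ e.target, w i =ᶠ[𝓝 y] vectorDensity g c X i := by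
    intro i y hy
    filter_upwards [e.open_target.mem_nhds hy] with z hz using indicator_of_mem hz _
  have hwsm : ∀ i, ContDiff ℝ 1 (w i) := by
    intro i
    refine contDiff_iff_contDiffAt.2 fun y => ?_
    by_cases hy : y ∈ e.target
    · exact ((contDiffOn_vectorDensity g c hX i).contDiffAt
        (e.open_target.mem_nhds hy)).congr_of_eventuallyEq (hweq i y hy)
    · have : w i =ᶠ[𝓝 y] fun _ => 0 := by
        filter_upwards [hKcomp.isClosed.isOpen_compl.mem_nhds fun hmem => hy (hKt hmem)] with z hz
          using hw0 i z hz
      exact contDiffAt_const.congr_of_eventuallyEq this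
  have hint : ∀ y ∈ e.target, density g c y * divergence g X (e.symm y) =
      ∑ i, fderiv ℝ (w i) y (EuclideanSpace.single i 1) := by
    intro y hy
    rw [divergence_eq_divergenceIn g hX c (e.map_target hy), divergenceIn]
    change density g c y * ((density g c (e (e.symm y)))⁻¹ *
      ∑ i, fderiv ℝ (vectorDensity g c X i) (e (e.symm y)) _) = _
    rw [e.right_inv hy, mul_inv_cancel_left₀ (density_pos g c hy).ne']
    exact Finset.sum_congr rfl fun i _ => by rw [(hweq i y hy).fderiv_eq]
  rw [setIntegral_congr_fun (measurableSet_target c) hint,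
    setIntegral_eq_integral_of_forall_compl_eq_zero]
  · rw [integral_finsetSum]
    · exact Finset.sum_eq_zero fun i _ => integral_fderiv_eq_zero (hwsm i) (hwc i) _
    · intro i _
      exact (((hwsm i).continuous_fderiv (by norm_num)).clm_apply
        continuous_const).integrable_of_hasCompactSupport ((hwc i).fderiv_apply ℝ _)
  · intro y hy
    refine Finset.sum_eq_zero fun i _ => ?_
    have : w i =ᶠ[𝓝 y] fun _ => 0 := by
      filter_upwards [hKcomp.isClosed.isOpen_compl.mem_nhds fun hmem => hy (hKt hmem)] with z hz
        using hw0 i z hz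
    simp [this.fderiv_eq]

end ChartVolume

/-! ### Derivatives along a field and the divergence theorem on `M`. -/

section DirDeriv

variable {M : Type*} [TopologicalSpace M] [ChartedSpace Plane M] [IsManifold (𝓡 2) ∞ M]

theorem IsC1Field.smul {X : VField M} (hX : IsC1Field X) {a : M → ℝ}
    (ha : ContMDiff (𝓡 2) 𝓘(ℝ, ℝ) 1 a) : IsC1Field (fun x => a x • X x) := by
  rw [isC1Field_iff] at hX ⊢
  intro c
  have h := (contMDiffOn_iff_contDiffOn_chart c a (by norm_num)).1 ha.contMDiffOn
  refine (h.smul (hX c)).congr fun y _ => ?_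
  exact components_smul c a X _

omit [IsManifold (𝓡 2) ∞ M] in
theorem dirDeriv_congr {a b : M → ℝ} {x : M} (h : a =ᶠ[𝓝 x] b) (X : VField M) :
    dirDeriv a X x = dirDeriv b X x := by
  simp only [dirDeriv, h.mfderiv_eq]
  rfl

omit [IsManifold (𝓡 2) ∞ M] in
theorem dirDeriv_const (k : ℝ) (X : VField M) (x : M) : dirDeriv (fun _ => k) X x = 0 := by
  simp only [dirDeriv, mfderiv_const]
  rfl

omit [IsManifold (𝓡 2) ∞ M] in
theorem dirDeriv_add {a b : M → ℝ} {x : M} (ha : MDifferentiableAt (𝓡 2) 𝓘(ℝ, ℝ) a x)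
    (hb : MDifferentiableAt (𝓡 2) 𝓘(ℝ, ℝ) b x) (X : VField M) :
    dirDeriv (fun z => a z + b z) X x = dirDeriv a X x + dirDeriv b X x :=
  congrArg (fun l => l (X x)) (ha.hasMFDerivAt.add hb.hasMFDerivAt).mfderiv

omit [IsManifold (𝓡 2) ∞ M] in
theorem dirDeriv_mul {a b : M → ℝ} {x : M} (ha : MDifferentiableAt (𝓡 2) 𝓘(ℝ, ℝ) a x)
    (hb : MDifferentiableAt (𝓡 2) 𝓘(ℝ, ℝ) b x) (X : VField M) :
    dirDeriv (fun z => a z * b z) X x = a x * dirDeriv b X x + b x * dirDeriv a X x :=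
  congrArg (fun l => l (X x)) (ha.hasMFDerivAt.mul hb.hasMFDerivAt).mfderiv

omit [IsManifold (𝓡 2) ∞ M] in
theorem mdifferentiableAt_finset_sum {ι : Type*} (s : Finset ι) {a : ι → M → ℝ} {x : M}
    (ha : ∀ i ∈ s, MDifferentiableAt (𝓡 2) 𝓘(ℝ, ℝ) (a i) x) :
    MDifferentiableAt (𝓡 2) 𝓘(ℝ, ℝ) (fun z => ∑ i ∈ s, a i z) x := by
  classical
  induction s using Finset.induction_on with
  | empty => simpa using mdifferentiableAt_const
  | insert i s hi ih =>
    simp only [Finset.sum_insert hi]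
    exact (ha i (Finset.mem_insert_self i s)).add
      (ih fun j hj => ha j (Finset.mem_insert_of_mem hj))

theorem dirDeriv_sum {ι : Type*} (s : Finset ι) {a : ι → M → ℝ} {x : M}
    (ha : ∀ i ∈ s, MDifferentiableAt (𝓡 2) 𝓘(ℝ, ℝ) (a i) x) (X : VField M) :
    dirDeriv (fun z => ∑ i ∈ s, a i z) X x = ∑ i ∈ s, dirDeriv (a i) X x := by
  classical
  induction s using Finset.induction_on with
  | empty => simpa using dirDeriv_const 0 X x
  | insert i s hi ih =>
    have hs : ∀ j ∈ s, MDifferentiableAt (𝓡 2) 𝓘(ℝ, ℝ) (a j) x :=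
      fun j hj => ha j (Finset.mem_insert_of_mem hj)
    simp only [Finset.sum_insert hi]
    rw [dirDeriv_add (ha i (Finset.mem_insert_self i s)) (mdifferentiableAt_finset_sum s hs), ih hs]

theorem continuous_dirDeriv (g : Metric M) {X : VField M} (hX : IsC1Field X) {a : M → ℝ}
    (ha : ContMDiff (𝓡 2) 𝓘(ℝ, ℝ) 1 a) : Continuous (dirDeriv a X) := by
  -- The product rule expresses the derivative through divergences, whose continuity is known.
  have h : dirDeriv a X = fun x => divergence g (fun z => a z • X z) x - a x * divergence g X x := by
    ext x
    rw [divergence_smul g hX (ha.mdifferentiableAt (by norm_num))]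
    ring
  rw [h]
  exact (continuous_divergence g (hX.smul ha)).sub
    (ha.continuous.mul (continuous_divergence g hX))

theorem inner_grad_eq_dirDeriv (g : Metric M) (f : M → ℝ) (X : VField M) (x : M) :
    g.inner x (grad g f x) (X x) = dirDeriv f X x := inner_grad g f x (X x)

theorem exists_partition_of_unity [CompactSpace M] [T2Space M] (U : M → Set M)
    (hU : ∀ x, IsOpen (U x)) (hxU : ∀ x, x ∈ U x) :
    ∃ (s : Finset M) (ψ : M → M → ℝ), (∀ i, ContMDiff (𝓡 2) 𝓘(ℝ, ℝ) ∞ (ψ i)) ∧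
      (∀ i x, 0 ≤ ψ i x) ∧ (∀ i x, ψ i x ≤ 1) ∧ (∀ i, tsupport (ψ i) ⊆ U i) ∧
      ∀ x, ∑ i ∈ s, ψ i x = 1 := by
  obtain ⟨p, hp⟩ := SmoothPartitionOfUnity.exists_isSubordinate (𝓡 2) isClosed_univ U hU
    fun x _ => mem_iUnion.2 ⟨x, hxU x⟩
  have hfin : {i | (Function.support (p i)).Nonempty}.Finite :=
    p.locallyFinite.finite_nonempty_of_compact
  refine ⟨hfin.toFinset, fun i => p i, fun i => (p i).contMDiff, fun i x => p.nonneg i x,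
    fun i x => p.le_one i x, hp, fun x => ?_⟩
  have h1 := p.sum_eq_one (mem_univ x)
  rw [← h1, finsum_eq_sum_of_support_subset]
  intro i hi
  simp only [Finite.coe_toFinset, mem_ofPred_eq]
  exact ⟨x, hi⟩

variable [CompactSpace M] [T2Space M] [Nonempty M] [MeasurableSpace M] [BorelSpace M]

/-- The divergence theorem on the closed surface `M`. -/
theorem integral_divergence (g : Metric M) {X : VField M} (hX : IsC1Field X) :
    ∫ x, divergence g X x ∂(riemannianVolume g) = 0 := by
  obtain ⟨s, ψ, hψ, -, -, hsub, hsum⟩ := exists_partition_of_unity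
    (fun c : M => (chartAt Plane c).source) (fun c => (chartAt Plane c).open_source)
    (fun c => mem_chart_source Plane c)
  have hψ1 : ∀ i, ContMDiff (𝓡 2) 𝓘(ℝ, ℝ) 1 (ψ i) := fun i => (hψ i).of_le (by norm_num)
  have hψd : ∀ i x, MDifferentiableAt (𝓡 2) 𝓘(ℝ, ℝ) (ψ i) x :=
    fun i x => (hψ1 i).mdifferentiableAt (by norm_num)
  have hdec : ∀ x, divergence g X x = ∑ i ∈ s, divergence g (fun z => ψ i z • X z) x := by
    intro x
    -- The derivative terms of the product rule add up to the derivative of the constant `1`.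
    have h0 : ∑ i ∈ s, dirDeriv (ψ i) X x = 0 := by
      rw [← dirDeriv_sum s fun i _ => hψd i x]
      simp only [hsum]
      exact dirDeriv_const 1 X x
    rw [Finset.sum_congr rfl fun i _ => divergence_smul g hX (hψd i x), Finset.sum_add_distrib, h0,
      ← Finset.sum_mul, hsum]
    ring
  simp only [hdec]
  rw [integral_finsetSum]
  · refine Finset.sum_eq_zero fun i _ => ?_
    refine integral_divergence_of_subset_source g i (hX.smul (hψ1 i))
      (isClosed_tsupport (ψ i)).isCompact (hsub i) fun x hx => ?_
    rw [image_eq_zero_of_notMem_tsupport hx]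
    exact zero_smul ℝ (X x)
  · intro i _
    exact (continuous_divergence g (hX.smul (hψ1 i))).integrable_of_hasCompactSupport
      (HasCompactSupport.of_compactSpace _)

end DirDeriv

/-! ### Cutoffs in the plane with bounded derivative along one field. -/

section Cutoff

theorem deriv_le_of_forall_le {s : ℝ → ℝ} {s' D C T : ℝ} (hT : 0 < T) (hs : HasDerivAt s s' 0)
    (h : ∀ t, 0 < t → t < T → s t - s 0 ≤ t * D + C * t ^ 2) : s' ≤ D := by
  have h1 : Tendsto (fun t : ℝ => t⁻¹ • (s (0 + t) - s 0)) (𝓝[>] 0) (𝓝 s') :=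
    hs.tendsto_slope_zero_right
  have h2 : Tendsto (fun t : ℝ => D + C * t) (𝓝[>] 0) (𝓝 D) := by
    have : Tendsto (fun t : ℝ => D + C * t) (𝓝 0) (𝓝 (D + C * 0)) :=
      Continuous.tendsto (by fun_prop) 0
    rw [mul_zero, add_zero] at this
    exact this.mono_left nhdsWithin_le_nhds
  refine le_of_tendsto_of_tendsto h1 h2 ?_
  filter_upwards [Ioo_mem_nhdsGT hT] with t ht
  have h3 := h t ht.1 ht.2
  rw [zero_add, smul_eq_mul, inv_mul_le_iff₀ ht.1]
  linarith

/-- An upper bound on increments at both signs of `t` bounds the derivative from both sides; this is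
why invariance is required for past and future times. -/
theorem abs_deriv_le_of_forall_le {s : ℝ → ℝ} {s' D C T : ℝ} (hT : 0 < T) (hs : HasDerivAt s s' 0)
    (h : ∀ t, |t| < T → s t - s 0 ≤ |t| * D + C * t ^ 2) : |s'| ≤ D := by
  refine abs_le'.2 ⟨deriv_le_of_forall_le hT hs (C := C) fun t h0 ht => ?_,
    deriv_le_of_forall_le (s := fun t => s (-t)) hT ?_ (C := C) fun t h0 ht => ?_⟩
  · simpa [abs_of_pos h0] using h t (by rwa [abs_of_pos h0])
  · have hs' : HasDerivAt s s' (-0) := by rwa [neg_zero]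
    have h1 := hs'.comp (0 : ℝ) (hasDerivAt_neg (0 : ℝ))
    rw [mul_neg_one] at h1
    exact h1
  · simpa [abs_of_pos h0] using h (-t) (by rwa [abs_neg, abs_of_pos h0])

variable {Z : Set Plane} {F : Plane → Plane} {x₀ : Plane} {K C T r : ℝ}

/-- Near an almost invariant closed set `Z`, the distance to `Z` grows at most exponentially along
`F`. -/
theorem infDist_add_smul_le (hZ : IsClosed Z) (hZne : Z.Nonempty)
    (hF : ∀ x y, ‖F x - F y‖ ≤ K * ‖x - y‖)
    (hinv : ∀ z ∈ Z, dist z x₀ < r → ∀ t, |t| < T → ∃ w ∈ Z, ‖w - (z + t • F z)‖ ≤ C * t ^ 2)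
    {x : Plane} (hx : dist x x₀ + Metric.infDist x Z < r) {t : ℝ} (ht : |t| < T) :
    Metric.infDist (x + t • F x) Z ≤
      Metric.infDist x Z + |t| * (K * Metric.infDist x Z) + C * t ^ 2 := by
  obtain ⟨z, hz, hxz⟩ := hZ.exists_infDist_eq_dist hZne x
  -- `z` is a nearest point of `Z`; the hypothesis on `x` keeps it in the ball where `Z` is almost
  -- invariant. The increment of the distance is then estimated by moving `z` along with `x`.
  have hzr : dist z x₀ < r := by
    have := dist_triangle z x x₀
    rw [dist_comm z x] at this
    linarith
  obtain ⟨w, hw, hwz⟩ := hinv z hz hzr t ht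
  have h1 : x + t • F x - w = (x - z) + t • (F x - F z) - (w - (z + t • F z)) := by
    rw [smul_sub]; abel
  have h2 : ‖x + t • F x - w‖ ≤ ‖x - z‖ + |t| * (K * ‖x - z‖) + C * t ^ 2 := by
    rw [h1]
    refine (norm_sub_le _ _).trans (add_le_add ((norm_add_le _ _).trans ?_) hwz)
    rw [norm_smul, Real.norm_eq_abs]
    gcongr
    exact hF x z
  refine (Metric.infDist_le_dist_of_mem hw).trans ?_
  rw [hxz, dist_eq_norm, dist_eq_norm]
  exact h2

open scoped Convolution in
/-- A smooth function close to the distance to `Z`, with small derivative along `F`. -/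
theorem exists_smooth_infDist (hZ : IsClosed Z) (hZne : Z.Nonempty) (hK : 0 ≤ K) (hT : 0 < T)
    (hF : ∀ x y, ‖F x - F y‖ ≤ K * ‖x - y‖)
    (hinv : ∀ z ∈ Z, dist z x₀ < r → ∀ t, |t| < T → ∃ w ∈ Z, ‖w - (z + t • F z)‖ ≤ C * t ^ 2)
    {δ : ℝ} (hδ : 0 < δ) :
    ∃ u : Plane → ℝ, ContDiff ℝ ∞ u ∧ (∀ x, |u x - Metric.infDist x Z| ≤ δ) ∧
      ∀ x, dist x x₀ + Metric.infDist x Z + 2 * δ < r →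
        |fderiv ℝ u x (F x)| ≤ K * (Metric.infDist x Z + 2 * δ) := by
  set d : Plane → ℝ := fun x => Metric.infDist x Z with hd
  have hdc : Continuous d := Metric.continuous_infDist_pt Z
  have hdl : ∀ x y, d x ≤ d y + dist x y := fun x y => Metric.infDist_le_infDist_add_dist
  let φ : ContDiffBump (0 : Plane) := ⟨δ / 2, δ, half_pos hδ, half_lt_self hδ⟩
  set ρ := φ.normed (volume : Measure Plane) with hρ
  set u : Plane → ℝ := ρ ⋆[ContinuousLinearMap.lsmul ℝ ℝ, volume] d with hu
  have husm : ContDiff ℝ ∞ u :=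
    φ.hasCompactSupport_normed.contDiff_convolution_left _ φ.contDiff_normed
      hdc.locallyIntegrable
  have huval : ∀ x, u x = ∫ y, ρ y * d (x - y) := fun x => by
    simp [hu, convolution, ContinuousLinearMap.lsmul_apply]
  have hint : ∀ x, Integrable (fun y => ρ y * d (x - y)) := fun x =>
    Continuous.integrable_of_hasCompactSupport
      (φ.continuous_normed.mul (hdc.comp (continuous_const.sub continuous_id)))
      φ.hasCompactSupport_normed.mul_right
  refine ⟨u, husm, fun x => ?_, fun x hx => ?_⟩
  · have h := φ.dist_normed_convolution_le (μ := (volume : Measure Plane)) (g := d) (x₀ := x)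
      (ε := δ) hdc.aestronglyMeasurable fun y hy => by
        rw [Real.dist_eq, abs_sub_le_iff]
        have h1 := hdl x y
        have h2 := hdl y x
        have h3 : dist y x < δ := hy
        rw [dist_comm x y] at h1
        constructor <;> linarith
    rwa [Real.dist_eq] at h
  · have hder : HasDerivAt (fun t : ℝ => u (x + t • F x)) (fderiv ℝ u x (F x)) 0 := by
      have h1 : HasDerivAt (fun t : ℝ => x + t • F x) (F x) 0 := by
        simpa using ((hasDerivAt_id (0 : ℝ)).smul_const (F x)).const_add x
      have h2 : HasFDerivAt u (fderiv ℝ u x) (x + (0 : ℝ) • F x) := by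
        rw [zero_smul, add_zero]
        exact (husm.differentiable (by norm_num) x).hasFDerivAt
      exact h2.comp_hasDerivAt (0 : ℝ) h1
    refine abs_deriv_le_of_forall_le (C := C) hT hder fun t ht => ?_
    simp only [zero_smul, add_zero]
    rw [huval, huval, ← integral_sub (hint _) (hint _)]
    -- The mollifier has mass one, so the bound is itself an average. It therefore suffices to bound
    -- the increments of `d` pointwise, although `d` need not be differentiable.
    have hone : ∫ y, ρ y * (|t| * (K * (d x + 2 * δ)) + C * t ^ 2) =
        |t| * (K * (d x + 2 * δ)) + C * t ^ 2 := by
      rw [integral_mul_const, hρ, φ.integral_normed, one_mul]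
    rw [← hone]
    refine integral_mono ((hint _).sub (hint _)) (φ.integrable_normed.mul_const _) fun y => ?_
    simp only
    rw [← mul_sub]
    by_cases hy : y ∈ Metric.ball (0 : Plane) δ
    · refine mul_le_mul_of_nonneg_left ?_ (φ.nonneg_normed y)
      have hyn : ‖y‖ < δ := by simpa using hy
      have hdy : dist (x - y) x = ‖y‖ := by simp
      have h1 : d (x - y) ≤ d x + δ := by
        have := hdl (x - y) x
        linarith
      have h2 := infDist_add_smul_le (x := x - y) hZ hZne hF hinv (by
        have := dist_triangle (x - y) x x₀
        change dist (x - y) x₀ + d (x - y) < r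
        change dist x x₀ + d x + 2 * δ < r at hx
        linarith) ht
      -- The mollified increment moves `x - y` in direction `F x` instead of `F (x - y)`; the
      -- Lipschitz bound on `F` makes the cost `K * δ` per unit time, the second `δ` in `2 * δ`.
      have h3 : d (x + t • F x - y) ≤ d (x - y + t • F (x - y)) + |t| * (K * δ) := by
        have := hdl (x + t • F x - y) (x - y + t • F (x - y))
        have h4 : dist (x + t • F x - y) (x - y + t • F (x - y)) = |t| * ‖F x - F (x - y)‖ := by
          rw [dist_eq_norm, ← Real.norm_eq_abs, ← norm_smul, smul_sub]
          congr 1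
          abel
        have h5 : ‖F x - F (x - y)‖ ≤ K * δ := by
          refine (hF _ _).trans ?_
          rw [sub_sub_cancel]
          gcongr
        have h6 := mul_le_mul_of_nonneg_left h5 (abs_nonneg t)
        linarith
      change d (x - y + t • F (x - y)) ≤ d (x - y) + |t| * (K * d (x - y)) + C * t ^ 2 at h2
      have h7 : |t| * (K * d (x - y)) ≤ |t| * (K * (d x + δ)) := by gcongr
      have h8 : |t| * (K * (d x + 2 * δ)) = |t| * (K * (d x + δ)) + |t| * (K * δ) := by ring
      linarith
    · have h0 : ρ y = 0 := by
        have : y ∉ Function.support ρ := by rw [hρ, φ.support_normed_eq]; exact hy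
        simpa using this
      rw [h0, zero_mul, zero_mul]

/-- Smooth cutoff functions that vanish near the almost invariant closed set `Z` and whose
derivatives along `F` are uniformly bounded. -/
theorem exists_cutoff (hZ : IsClosed Z) (hZne : Z.Nonempty) (hK : 0 ≤ K) (hT : 0 < T) (hr : 0 < r)
    (hF : ∀ x y, ‖F x - F y‖ ≤ K * ‖x - y‖)
    (hinv : ∀ z ∈ Z, dist z x₀ < 2 * r →
      ∀ t, |t| < T → ∃ w ∈ Z, ‖w - (z + t • F z)‖ ≤ C * t ^ 2) :
    ∃ (χ : ℕ → Plane → ℝ) (δ : ℕ → ℝ) (C' : ℝ), (∀ n, 0 < δ n) ∧ Tendsto δ atTop (𝓝 0) ∧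
      (∀ n, ContDiff ℝ ∞ (χ n)) ∧ (∀ n x, 0 ≤ χ n x) ∧ (∀ n x, χ n x ≤ 1) ∧
      (∀ n x, χ n x ≠ 0 → δ n ≤ Metric.infDist x Z) ∧
      (∀ n x, 4 * δ n < Metric.infDist x Z → χ n x = 1) ∧
      ∀ n x, dist x x₀ < r → |fderiv ℝ (χ n) x (F x)| ≤ C' := by
  -- The transition function is constant on each side of `[0, 1]`, so compactness bounds its
  -- derivative everywhere.
  obtain ⟨B, hB⟩ : ∃ B, ∀ s, |deriv Real.smoothTransition s| ≤ B := by
    have hcont : Continuous (deriv Real.smoothTransition) :=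
      Real.smoothTransition.contDiff (n := 1) |>.continuous_deriv le_rfl
    obtain ⟨B, hB⟩ := (isCompact_Icc (a := (0 : ℝ)) (b := 1)).exists_bound_of_continuousOn
      hcont.continuousOn
    refine ⟨max B 0, fun s => ?_⟩
    by_cases hs : s ∈ Icc (0 : ℝ) 1
    · exact (hB s hs).trans (le_max_left _ _)
    · have h0 : deriv Real.smoothTransition s = 0 := by
        rw [mem_Icc, not_and_or, not_le, not_le] at hs
        rcases hs with hs | hs
        · have : Real.smoothTransition =ᶠ[𝓝 s] fun _ => 0 := by
            filter_upwards [gt_mem_nhds hs] with z hz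
            exact Real.smoothTransition.zero_of_nonpos hz.le
          rw [this.deriv_eq, deriv_const]
        · have : Real.smoothTransition =ᶠ[𝓝 s] fun _ => 1 := by
            filter_upwards [lt_mem_nhds hs] with z hz
            exact Real.smoothTransition.one_of_one_le hz.le
          rw [this.deriv_eq, deriv_const]
      rw [h0, abs_zero]
      exact le_max_right _ _
  have hB0 : 0 ≤ B := (abs_nonneg _).trans (hB 0)
  -- If `dist x x₀ < r` and the distance to `Z` is at most `4 * δ n`, then `r + 6 * δ n ≤ 7 * r / 4
  -- < 2 * r`, which is the range where `exists_smooth_infDist` applies.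
  set δ : ℕ → ℝ := fun n => r / 8 / (n + 1) with hδdef
  have hδ : ∀ n, 0 < δ n := fun n => by positivity
  have hδr : ∀ n, δ n ≤ r / 8 := fun n => by
    apply div_le_self (by positivity)
    have : (0 : ℝ) ≤ n := n.cast_nonneg
    linarith
  have hδlim : Tendsto δ atTop (𝓝 0) := tendsto_const_div_atTop_nhds_zero_nat (r / 8) |>.comp
    (tendsto_add_atTop_nat 1) |>.congr fun n => by simp [hδdef]
  choose u husm hud hufd using fun n => exists_smooth_infDist hZ hZne hK hT hF hinv (hδ n)
  -- As `u n` is within `δ n` of the distance, the argument is negative at distance below `δ n` and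
  -- exceeds `1` at distance above `4 * δ n`.
  refine ⟨fun n x => Real.smoothTransition ((u n x - 2 * δ n) / δ n), δ, B * (6 * K), hδ, hδlim,
    fun n => ?_, fun n x => Real.smoothTransition.nonneg _, fun n x => Real.smoothTransition.le_one _,
    fun n x hx => ?_, fun n x hx => ?_, fun n x hx => ?_⟩
  · exact Real.smoothTransition.contDiff.comp (((husm n).sub contDiff_const).div_const _)
  · by_contra! hlt
    refine hx (Real.smoothTransition.zero_of_nonpos (div_nonpos_of_nonpos_of_nonneg ?_ (hδ n).le))
    have := (abs_le.1 (hud n x)).2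
    linarith
  · refine Real.smoothTransition.one_of_one_le ((one_le_div (hδ n)).2 ?_)
    have := (abs_le.1 (hud n x)).1
    linarith
  · have hud' : HasFDerivAt (u n) (fderiv ℝ (u n) x) x :=
      ((husm n).differentiable (by norm_num) x).hasFDerivAt
    have hin : HasFDerivAt (fun x => (u n x - 2 * δ n) / δ n) ((δ n)⁻¹ • fderiv ℝ (u n) x) x := by
      have := (hud'.sub_const (2 * δ n)).const_mul (δ n)⁻¹
      simpa only [div_eq_inv_mul] using this
    have hst : HasDerivAt Real.smoothTransition
        (deriv Real.smoothTransition ((u n x - 2 * δ n) / δ n)) ((u n x - 2 * δ n) / δ n) :=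
      ((Real.smoothTransition.contDiff (n := 1)).differentiable (by norm_num) _).hasDerivAt
    have hcomp := hst.comp_hasFDerivAt x hin
    change |fderiv ℝ (Real.smoothTransition ∘ fun x => (u n x - 2 * δ n) / δ n) x (F x)| ≤ _
    rw [hcomp.fderiv]
    simp only [smul_apply, smul_eq_mul, abs_mul]
    -- Far from `Z` the cutoff is locally constant. Near `Z` the factor `1 / δ n` is absorbed by
    -- `|∂_F u| ≤ K (d + 2δ) ≤ 6Kδ`, which gives a bound independent of `n`.
    by_cases hlarge : 4 * δ n < Metric.infDist x Z
    · have h0 : deriv Real.smoothTransition ((u n x - 2 * δ n) / δ n) = 0 := by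
        have h1 : 1 < (u n x - 2 * δ n) / δ n := by
          rw [one_lt_div (hδ n)]
          have := (abs_le.1 (hud n x)).1
          linarith
        have : Real.smoothTransition =ᶠ[𝓝 ((u n x - 2 * δ n) / δ n)] fun _ => 1 := by
          filter_upwards [lt_mem_nhds h1] with z hz
          exact Real.smoothTransition.one_of_one_le hz.le
        rw [this.deriv_eq, deriv_const]
      rw [h0, abs_zero, zero_mul]
      positivity
    · rw [not_lt] at hlarge
      have h1 := hufd n x (by have := hδr n; linarith)
      have h2 : |(δ n)⁻¹| * |fderiv ℝ (u n) x (F x)| ≤ 6 * K := by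
        rw [abs_of_pos (inv_pos.2 (hδ n)), inv_mul_le_iff₀ (hδ n)]
        refine h1.trans ?_
        have : K * (Metric.infDist x Z + 2 * δ n) ≤ K * (6 * δ n) := by
          gcongr; linarith
        linarith
      exact mul_le_mul (hB _) h2 (by positivity) hB0

end Cutoff

/-! ### Short-time flow in the plane. -/

section PlaneFlow

open scoped NNReal

/-- The flow of a bounded Lipschitz field on the plane, for short times. -/
theorem exists_plane_flow {F : Plane → Plane} {K : ℝ≥0} {A : ℝ} (hF : LipschitzWith K F)
    (hA : ∀ x, ‖F x‖ ≤ A) (x₀ : Plane) {R : ℝ} (hR : 0 < R) :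
    ∃ (T C : ℝ) (α : Plane → ℝ → Plane), 0 < T ∧
      (∀ z ∈ Metric.ball x₀ R, α z 0 = z ∧ ∀ t, |t| < T → α z t ∈ Metric.ball x₀ (2 * R) ∧
        HasDerivAt (α z) (F (α z t)) t ∧ ‖α z t - (z + t • F z)‖ ≤ C * t ^ 2) ∧
      ∀ t, |t| < T → ContinuousOn (fun z => α z t) (Metric.ball x₀ R) := by
  have hA0 : 0 ≤ A := (norm_nonneg _).trans (hA 0)
  -- At speed at most `A` a trajectory moves at most `R` in time `T`; the `+ 1` avoids division by
  -- zero.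
  set T := R / (A + 1) with hTdef
  have hT : 0 < T := by positivity
  have hAT : A * T ≤ R := by
    rw [hTdef, ← mul_div_assoc, div_le_iff₀ (by positivity)]
    nlinarith
  have h0 : (0 : ℝ) ∈ Icc (-T) T := ⟨by linarith, hT.le⟩
  have hpl : IsPicardLindelof (fun _ => F) (tmin := -T) (tmax := T) ⟨0, h0⟩ x₀
      ⟨2 * R, by positivity⟩ ⟨R, hR.le⟩ ⟨A, hA0⟩ K := by
    refine .of_time_independent (fun x _ => hA x) hF.lipschitzOnWith ?_
    simp only [sub_zero, zero_sub, neg_neg, max_self]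
    change A * T ≤ 2 * R - R
    linarith
  obtain ⟨α, hα, L', hL'⟩ :=
    hpl.exists_forall_mem_closedBall_eq_hasDerivWithinAt_lipschitzOnWith
  refine ⟨T, K * A, α, hT, fun z hz => ?_, fun t ht => ?_⟩
  · obtain ⟨hz0, hzd⟩ := hα z (Metric.ball_subset_closedBall hz)
    change α z 0 = z at hz0
    have hmv : ∀ t, |t| ≤ T → ‖α z t - z‖ ≤ A * |t| := by
      intro t ht
      have := (convex_Icc (-T) T).norm_image_sub_le_of_norm_hasDerivWithin_le
        (fun s hs => hzd s hs) (fun s _ => hA _) h0 (abs_le.1 ht)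
      rwa [hz0, sub_zero, Real.norm_eq_abs] at this
    refine ⟨hz0, fun t ht => ⟨?_, ?_, ?_⟩⟩
    · have h1 : ‖α z t - z‖ ≤ R := (hmv t ht.le).trans
        ((mul_le_mul_of_nonneg_left ht.le hA0).trans hAT)
      rw [Metric.mem_ball] at hz ⊢
      rw [← dist_eq_norm] at h1
      have := dist_triangle (α z t) z x₀
      linarith
    · exact (hzd t (abs_le.1 ht.le)).hasDerivAt (Icc_mem_nhds (abs_lt.1 ht).1 (abs_lt.1 ht).2)
    -- The mean value inequality is applied to `α z s - s • F z`, whose derivative `F (α z s) - F z`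
    -- has norm at most `K * (A * |t|)`; hence the constant `K * A`.
    · have hsub : Icc (-|t|) |t| ⊆ Icc (-T) T := Icc_subset_Icc (by linarith) ht.le
      have hd : ∀ s ∈ Icc (-|t|) |t|, HasDerivWithinAt (fun s => α z s - s • F z)
          (F (α z s) - F z) (Icc (-|t|) |t|) s := by
        intro s hs
        have h1 := ((hasDerivAt_id s).smul_const (F z)).hasDerivWithinAt (s := Icc (-|t|) |t|)
        rw [one_smul] at h1
        exact ((hzd s (hsub hs)).mono hsub).sub h1
      have hb : ∀ s ∈ Icc (-|t|) |t|, ‖F (α z s) - F z‖ ≤ K * (A * |t|) := by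
        intro s hs
        refine (hF.norm_sub_le _ _).trans ?_
        gcongr
        exact (hmv s ((abs_le.2 hs).trans ht.le)).trans
          (mul_le_mul_of_nonneg_left (abs_le.2 hs) hA0)
      have := (convex_Icc (-|t|) |t|).norm_image_sub_le_of_norm_hasDerivWithin_le hd hb
        (x := 0) (y := t) ⟨by simp, by simp⟩ ⟨neg_abs_le t, le_abs_self t⟩
      rw [hz0, zero_smul, sub_zero, sub_zero, Real.norm_eq_abs] at this
      rw [show α z t - (z + t • F z) = α z t - t • F z - z by abel]
      refine this.trans_eq ?_
      rw [← sq_abs t]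
      ring
  · exact (hL' t (abs_le.1 ht.le)).continuousOn.mono Metric.ball_subset_closedBall

end PlaneFlow

/-! ### Local and global flow of a `C¹` field on `M`. -/

section Flow

variable {M : Type*} [TopologicalSpace M] [ChartedSpace Plane M] [IsManifold (𝓡 2) ∞ M]

open scoped NNReal in
/-- The flow of a `C¹` field in a chart, for short times. -/
theorem exists_chart_flow {F : VField M} (hF : IsC1Field F) (x₀ : M) :
    ∃ (R T K C : ℝ) (Fh : Plane → Plane) (α : Plane → ℝ → Plane), 0 < R ∧ 0 < T ∧ 0 ≤ K ∧
      Metric.ball (chartAt Plane x₀ x₀) (2 * R) ⊆ (chartAt Plane x₀).target ∧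
      (∀ x y, ‖Fh x - Fh y‖ ≤ K * ‖x - y‖) ∧
      (∀ x ∈ Metric.ball (chartAt Plane x₀ x₀) (2 * R),
        Fh x = components x₀ F ((chartAt Plane x₀).symm x)) ∧
      (∀ z ∈ Metric.ball (chartAt Plane x₀ x₀) R, α z 0 = z ∧
        IsMIntegralCurveOn (fun t => (chartAt Plane x₀).symm (α z t)) F (Ioo (-T) T) ∧
        ∀ t, |t| < T → α z t ∈ (chartAt Plane x₀).target ∧
          ‖α z t - (z + t • Fh z)‖ ≤ C * t ^ 2) ∧
      ∀ t, |t| < T → ContinuousOn (fun z => α z t) (Metric.ball (chartAt Plane x₀ x₀) R) := by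
  set e := chartAt Plane x₀
  obtain ⟨ρ, hρ, hρt⟩ := Metric.nhds_basis_closedBall.mem_iff.1
    (e.open_target.mem_nhds (mem_chart_target Plane x₀))
  set R := ρ / 3 with hRdef
  have hR : 0 < R := by positivity
  let b : ContDiffBump (e x₀) := ⟨2 * R, ρ, by positivity, by rw [hRdef]; linarith⟩
  set Ft : Plane → Plane := components x₀ F ∘ e.symm
  have hFt : ContDiffOn ℝ 1 Ft e.target := (isC1Field_iff F).1 hF x₀
  -- The bump makes the field bounded and globally Lipschitz without changing it on the ball of
  -- radius `2 * R`, which the trajectories from the ball of radius `R` do not leave.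
  set Fh : Plane → Plane := fun y => b y • Ft y with hFhdef
  have hbsub : tsupport b ⊆ e.target := by rw [b.tsupport_eq]; exact hρt
  have hFhsm : ContDiff ℝ 1 Fh := by
    refine contDiff_iff_contDiffAt.2 fun y => ?_
    by_cases hy : y ∈ e.target
    · exact b.contDiffAt.smul (hFt.contDiffAt (e.open_target.mem_nhds hy))
    · have : Fh =ᶠ[𝓝 y] fun _ => 0 := by
        filter_upwards [(isClosed_tsupport b).isOpen_compl.mem_nhds fun h => hy (hbsub h)] with z hz
        rw [hFhdef]
        simp only
        rw [image_eq_zero_of_notMem_tsupport hz, zero_smul]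
      exact contDiffAt_const.congr_of_eventuallyEq this
  have hFhc : HasCompactSupport Fh := b.hasCompactSupport.smul_right
  obtain ⟨K, hK⟩ := hFhsm.lipschitzWith_of_hasCompactSupport hFhc (by norm_num)
  obtain ⟨A, hA⟩ := hFhc.exists_bound_of_continuous hFhsm.continuous
  obtain ⟨T, C, α, hT, hα, hαc⟩ := exists_plane_flow hK hA (e x₀) hR
  have hball : Metric.ball (e x₀) (2 * R) ⊆ e.target := fun y hy => hρt (by
    rw [Metric.mem_ball] at hy
    rw [Metric.mem_closedBall]
    linarith)
  have hFeq : ∀ x ∈ Metric.ball (e x₀) (2 * R), Fh x = components x₀ F (e.symm x) := by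
    intro x hx
    have : b x = 1 := b.one_of_mem_closedBall (Metric.ball_subset_closedBall hx)
    rw [hFhdef]
    simp only
    rw [this, one_smul]
    rfl
  refine ⟨R, T, K, C, Fh, α, hR, hT, K.coe_nonneg, hball, fun x y => hK.norm_sub_le x y, hFeq,
    fun z hz => ⟨(hα z hz).1, fun t ht => ?_, fun t ht =>
      ⟨hball ((hα z hz).2 t ht).1, ((hα z hz).2 t ht).2.2⟩⟩, hαc⟩
  have ht' : |t| < T := abs_lt.2 ht
  obtain ⟨hmem, hder, -⟩ := (hα z hz).2 t ht'
  have hsrc : e.symm (α z t) ∈ e.source := e.map_target (hball hmem)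
  have hsymm : HasMFDerivAt (𝓡 2) (𝓡 2) e.symm (α z t) (mfderiv (𝓡 2) (𝓡 2) e.symm (α z t)) :=
    ((mdifferentiable_chartAt x₀).mdifferentiableAt_symm (hball hmem)).hasMFDerivAt
  have hcomp := hsymm.comp t hder.hasFDerivAt.hasMFDerivAt
  refine HasMFDerivAt.hasMFDerivWithinAt ?_
  have hval := mfderiv_chart_symm_components x₀ F hsrc
  change (mfderiv (𝓡 2) (𝓡 2) e.symm (e (e.symm (α z t))) _ : Plane) = _ at hval
  rw [e.right_inv (hball hmem), ← hFeq _ hmem] at hval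
  refine (congrArg (fun l => HasMFDerivAt 𝓘(ℝ, ℝ) (𝓡 2) (e.symm ∘ α z) t l) ?_).mp hcomp
  refine ContinuousLinearMap.ext fun (s : ℝ) => ?_
  exact (map_smul (mfderiv (𝓡 2) (𝓡 2) e.symm (α z t)) (s : ℝ) _).trans
    (congrArg (fun v : Plane => (s : ℝ) • v) hval)

variable [T2Space M]

theorem IsMIntegralCurve.eq_of_isC1Field {F : VField M} (hF : IsC1Field F) {γ γ' : ℝ → M}
    (hγ : IsMIntegralCurve γ F) (hγ' : IsMIntegralCurve γ' F) {t : ℝ} (h : γ t = γ' t) : γ = γ' :=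
  have : IsManifold (𝓡 2) 1 M := isManifold_one
  isMIntegralCurve_Ioo_eq_of_contMDiff_boundaryless hF hγ hγ' h

omit [T2Space M] in
-- Compactness turns local existence times into one time for all starting points, which is what
-- extends integral curves to the whole line.
theorem exists_uniform_time [CompactSpace M] {F : VField M} (hF : IsC1Field F) :
    ∃ T > 0, ∀ x₀ : M, ∃ (N : Set M) (ψ : ℝ → M → M), N ∈ 𝓝 x₀ ∧
      (∀ y ∈ N, ψ 0 y = y ∧ IsMIntegralCurveOn (fun t => ψ t y) F (Ioo (-T) T)) ∧
      ∀ t, |t| < T → ContinuousOn (ψ t) N := by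
  have hloc : ∀ x₀ : M, ∃ (T : ℝ) (N : Set M) (ψ : ℝ → M → M), 0 < T ∧ IsOpen N ∧ x₀ ∈ N ∧
      (∀ y ∈ N, ψ 0 y = y ∧ IsMIntegralCurveOn (fun t => ψ t y) F (Ioo (-T) T)) ∧
      ∀ t, |t| < T → ContinuousOn (ψ t) N := by
    intro x₀
    obtain ⟨R, T, K, C, Fh, α, hR, hT, hK, hball, hlip, hFh, hα, hαc⟩ := exists_chart_flow hF x₀
    set e := chartAt Plane x₀
    refine ⟨T, e.source ∩ e ⁻¹' Metric.ball (e x₀) R, fun t y => e.symm (α (e y) t), hT,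
      e.isOpen_inter_preimage Metric.isOpen_ball,
      ⟨mem_chart_source Plane x₀, Metric.mem_ball_self hR⟩, fun y hy => ⟨?_, (hα _ hy.2).2.1⟩,
      fun t ht => ?_⟩
    · simp only [(hα _ hy.2).1]
      exact e.left_inv hy.1
    · exact e.continuousOn_symm.comp ((hαc t ht).comp (e.continuousOn.mono inter_subset_left)
        fun y hy => hy.2) fun y hy => ((hα _ hy.2).2.2 t ht).1
  choose T N ψ hT hNo hxN hψ hψc using hloc
  obtain ⟨s, hs⟩ := isCompact_univ.elim_nhds_subcover N fun x _ => (hNo x).mem_nhds (hxN x)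
  obtain ⟨T₀, hT₀, hT₀s⟩ : ∃ T₀ > 0, ∀ x ∈ s, T₀ ≤ T x := by
    rcases s.eq_empty_or_nonempty with rfl | hne
    · exact ⟨1, one_pos, by simp⟩
    · obtain ⟨x, hx, hmin⟩ := s.exists_min_image T hne
      exact ⟨T x, hT x, hmin⟩
  refine ⟨T₀, hT₀, fun x₀ => ?_⟩
  obtain ⟨i, hi, hxi⟩ := mem_iUnion₂.1 (hs.2 (mem_univ x₀))
  exact ⟨N i, ψ i, (hNo i).mem_nhds hxi, fun y hy => ⟨(hψ i y hy).1, (hψ i y hy).2.mono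
    (Ioo_subset_Ioo (neg_le_neg (hT₀s i hi)) (hT₀s i hi))⟩,
    fun t ht => hψc i t (ht.trans_le (hT₀s i hi))⟩

/-- The global flow of a `C¹` field on a closed surface. -/
theorem exists_flow [CompactSpace M] {F : VField M} (hF : IsC1Field F) :
    ∃ φ : ℝ → M → M, (∀ y, φ 0 y = y) ∧ (∀ y, IsMIntegralCurve (fun t => φ t y) F) ∧
      (∀ s t y, φ (s + t) y = φ s (φ t y)) ∧ ∀ t, Continuous (φ t) := by
  have : IsManifold (𝓡 2) 1 M := isManifold_one
  obtain ⟨T, hT, hloc⟩ := exists_uniform_time hF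
  have hex : ∀ y : M, ∃ γ : ℝ → M, γ 0 = y ∧ IsMIntegralCurve γ F :=
    exists_isMIntegralCurve_of_isMIntegralCurveOn hF hT fun y => by
      obtain ⟨N, ψ, hN, hψ, -⟩ := hloc y
      exact ⟨fun t => ψ t y, hψ y (mem_of_mem_nhds hN)⟩
  choose γ hγ0 hγ using hex
  have hadd : ∀ s t y, γ y (s + t) = γ (γ y t) s := by
    intro s t y
    have h1 : IsMIntegralCurve (fun s => γ y (s + t)) F := (hγ y).comp_add t
    have h2 := IsMIntegralCurve.eq_of_isC1Field hF h1 (hγ (γ y t)) (t := 0) (by simp [hγ0])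
    exact congrFun h2 s
  have hsmall : ∀ t, |t| < T → Continuous fun y => γ y t := by
    intro t ht
    refine continuous_iff_continuousAt.2 fun x₀ => ?_
    obtain ⟨N, ψ, hN, hψ, hψc⟩ := hloc x₀
    refine ((hψc t ht).continuousAt hN).congr ?_
    filter_upwards [hN] with y hy
    have h := isMIntegralCurveOn_Ioo_eqOn_of_contMDiff_boundaryless (t₀ := 0)
      ⟨neg_lt_zero.2 hT, hT⟩ hF (hψ y hy).2 ((hγ y).isMIntegralCurveOn _)
      (by rw [(hψ y hy).1, hγ0])
    exact h (abs_lt.1 ht)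
  refine ⟨fun t y => γ y t, hγ0, hγ, hadd, fun t => ?_⟩
  -- Continuity for arbitrary `t` follows by composing `n` flow maps of time `t / n`, each short
  -- enough for the local statement.
  obtain ⟨n, hn⟩ := exists_nat_gt (|t| / T)
  have hn0 : (0 : ℝ) < n := (div_nonneg (abs_nonneg t) hT.le).trans_lt hn
  have hstep : Continuous fun y => γ y (t / n) := hsmall _ (by
    rw [abs_div, abs_of_pos hn0, div_lt_iff₀ hn0]
    rwa [div_lt_iff₀ hT, mul_comm] at hn)
  have hiter : ∀ k : ℕ, Continuous fun y => γ y (k * (t / n)) := by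
    intro k
    induction k with
    | zero => simpa [hγ0] using continuous_id'
    | succ k ih =>
      have : (fun y => γ y ((k + 1 : ℕ) * (t / n))) =
          fun y => γ (γ y (k * (t / n))) (t / n) := by
        ext y
        rw [← hadd]
        congr 1
        push_cast
        ring
      rw [this]
      exact hstep.comp ih
  have := hiter n
  rwa [mul_div_cancel₀ _ hn0.ne'] at this

end Flow

/-! ### Exhausting an open set with invariant complement by cutoffs. -/

section Exhaustion

variable {M : Type*} [TopologicalSpace M] [ChartedSpace Plane M] [IsManifold (𝓡 2) ∞ M]
  [T2Space M] [CompactSpace M]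

/-- Transfers `exists_cutoff` to a chart and multiplies by `ψ`, which localizes the cutoffs: off its
support the product vanishes, and its own derivative along `F` is bounded by compactness. -/
theorem exists_local_exhaustion (g : Metric M) {F : VField M} (hF : IsC1Field F) {Ω : Set M}
    (hΩ : IsOpen Ω)
    (hinv : ∀ γ : ℝ → M, IsMIntegralCurve γ F → γ 0 ∉ Ω → ∀ t, γ t ∉ Ω) (x₀ : M) :
    ∃ N : Set M, IsOpen N ∧ x₀ ∈ N ∧ ∀ ψ : M → ℝ, ContMDiff (𝓡 2) 𝓘(ℝ, ℝ) 1 ψ →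
      (∀ x, 0 ≤ ψ x) → (∀ x, ψ x ≤ 1) → tsupport ψ ⊆ N →
      ∃ (a : ℕ → M → ℝ) (B : ℝ), (∀ n, ContMDiff (𝓡 2) 𝓘(ℝ, ℝ) 1 (a n)) ∧
        (∀ n, tsupport (a n) ⊆ Ω) ∧ (∀ n x, |a n x| ≤ 1) ∧
        (∀ n x, |dirDeriv (a n) F x| ≤ B) ∧ ∀ x ∈ Ω, ∀ᶠ n in atTop, a n =ᶠ[𝓝 x] ψ := by
  have : IsManifold (𝓡 2) 1 M := isManifold_one
  obtain ⟨φ, hφ0, hφ, -, -⟩ := exists_flow hF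
  obtain ⟨R, T, K, C, Fh, α, hR, hT, hK, hball, hlip, hFh, hα, -⟩ := exists_chart_flow hF x₀
  set e := chartAt Plane x₀ with he
  set O : Set Plane := e.target ∩ e.symm ⁻¹' Ω with hO
  have hOo : IsOpen O := e.isOpen_inter_preimage_symm hΩ
  -- The exterior of the ball is put into `Z` so that `Z` is closed and nonempty in the whole plane.
  -- A point of `Z` inside the ball lies outside `Ω`, and its trajectory stays outside `Ω`, hence in
  -- `Z`.
  set Z : Set Plane := (O ∩ Metric.ball (e x₀) R)ᶜ with hZdef
  have hZ : IsClosed Z := (hOo.inter Metric.isOpen_ball).isClosed_compl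
  have hZne : Z.Nonempty := by
    obtain ⟨v, hv⟩ := NormedSpace.exists_lt_norm ℝ Plane R
    refine ⟨e x₀ + v, fun hmem => ?_⟩
    have : dist (e x₀ + v) (e x₀) < R := hmem.2
    rw [dist_eq_norm, add_sub_cancel_left] at this
    linarith
  have hZinv : ∀ z ∈ Z, dist z (e x₀) < 2 * (R / 2) → ∀ t, |t| < T →
      ∃ w ∈ Z, ‖w - (z + t • Fh z)‖ ≤ C * t ^ 2 := by
    intro z hz hzR t ht
    have hzR' : z ∈ Metric.ball (e x₀) R := by rw [Metric.mem_ball]; linarith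
    obtain ⟨h0, hcurve, htraj⟩ := hα z hzR'
    refine ⟨α z t, fun hmem => ?_, (htraj t ht).2⟩
    have hz0 : e.symm z ∉ Ω := by
      intro hzΩ
      refine hz ⟨⟨hball ?_, hzΩ⟩, hzR'⟩
      rw [Metric.mem_ball]; linarith
    have heq := isMIntegralCurveOn_Ioo_eqOn_of_contMDiff_boundaryless (t₀ := 0)
      ⟨neg_lt_zero.2 hT, hT⟩ hF hcurve ((hφ (e.symm z)).isMIntegralCurveOn _)
      (by simp only [h0, hφ0]) (abs_lt.1 ht)
    refine hinv _ (hφ (e.symm z)) (by rwa [hφ0]) t ?_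
    simp only at heq
    rw [← heq]
    exact hmem.1.2
  obtain ⟨χ, δ, C', hδ, hδlim, hχsm, hχ0, hχ1, hχsupp, hχone, hχF⟩ :=
    exists_cutoff hZ hZne hK hT (half_pos hR) hlip hZinv
  refine ⟨e.source ∩ e ⁻¹' Metric.ball (e x₀) (R / 2), e.isOpen_inter_preimage Metric.isOpen_ball,
    ⟨mem_chart_source Plane x₀, Metric.mem_ball_self (half_pos hR)⟩, fun ψ hψ hψ0 hψ1 hψN => ?_⟩
  have hesm : ContMDiffOn (𝓡 2) 𝓘(ℝ, Plane) 1 e e.source := contMDiffOn_chart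
  have hχe : ∀ n x, x ∈ e.source → ContMDiffAt (𝓡 2) 𝓘(ℝ, ℝ) 1 (fun z => χ n (e z)) x :=
    fun n x hx => (((hχsm n).of_le (by norm_num)).contMDiff).contMDiffAt.comp x
      (hesm.contMDiffAt (e.open_source.mem_nhds hx))
  have hoff : ∀ n, ∀ x ∉ tsupport ψ, (fun z => ψ z * χ n (e z)) =ᶠ[𝓝 x] fun _ => 0 := by
    intro n x hx
    filter_upwards [(isClosed_tsupport ψ).isOpen_compl.mem_nhds hx] with z hz
    rw [image_eq_zero_of_notMem_tsupport hz, zero_mul]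
  obtain ⟨Bψ, hBψ⟩ := isCompact_univ.exists_bound_of_continuousOn
    (continuous_dirDeriv g hF hψ).continuousOn
  refine ⟨fun n z => ψ z * χ n (e z), |C'| + |Bψ|, fun n x => ?_, fun n x hx => ?_, fun n x => ?_,
    fun n x => ?_, fun x hx => ?_⟩
  · by_cases hx : x ∈ tsupport ψ
    · exact (hψ x).mul (hχe n x (hψN hx).1)
    · exact contMDiffAt_const.congr_of_eventuallyEq (hoff n x hx)
  · have hxψ : x ∈ tsupport ψ := by
      by_contra h
      exact (notMem_tsupport_iff_eventuallyEq.2 (hoff n x h)) hx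
    obtain ⟨hxs, hxb⟩ := hψN hxψ
    have hdist : δ n ≤ Metric.infDist (e x) Z := by
      by_contra! hlt
      have hev : ∀ᶠ z in 𝓝 x, Metric.infDist (e z) Z < δ n :=
        ((Metric.continuous_infDist_pt Z).continuousAt.comp (e.continuousAt hxs)).eventually
          (gt_mem_nhds hlt)
      refine (notMem_tsupport_iff_eventuallyEq.2 ?_) hx
      filter_upwards [hev] with z hz
      have : χ n (e z) = 0 := by
        by_contra h
        exact (hχsupp n _ h).not_gt hz
      rw [this, mul_zero]
      rfl
    have hnot : e x ∉ Z := fun hmem => by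
      rw [Metric.infDist_zero_of_mem hmem] at hdist
      exact (hδ n).not_ge hdist
    rw [hZdef, notMem_compl_iff] at hnot
    have := hnot.1.2
    rwa [mem_preimage, e.left_inv hxs] at this
  · rw [abs_mul, abs_of_nonneg (hψ0 x), abs_of_nonneg (hχ0 n _)]
    exact mul_le_one₀ (hψ1 x) (hχ0 n _) (hχ1 n _)
  · by_cases hx : x ∈ tsupport ψ
    · obtain ⟨hxs, hxb⟩ := hψN hx
      have hd : MDifferentiableAt (𝓡 2) 𝓘(ℝ, ℝ) (fun z => χ n (e z)) x :=
        (hχe n x hxs).mdifferentiableAt (by norm_num)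
      rw [dirDeriv_mul (hψ.mdifferentiableAt (by norm_num)) hd]
      have hxb' : dist (e x) (e x₀) < R / 2 := hxb
      have h1 : dirDeriv (fun z => χ n (e z)) F x = fderiv ℝ (χ n) (e x) (Fh (e x)) := by
        rw [dirDeriv, mfderiv_eq_fderiv_chart x₀ hxs hd, hFh _ (by rw [Metric.mem_ball]; linarith),
          ← he, e.left_inv hxs]
        have : (fun z => χ n (e z)) ∘ e.symm =ᶠ[𝓝 (e x)] χ n := by
          filter_upwards [e.open_target.mem_nhds (e.map_source hxs)] with z hz
          simp [e.right_inv hz]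
        rw [this.fderiv_eq]
      rw [h1]
      refine (abs_add_le _ _).trans (add_le_add ?_ ?_)
      · rw [abs_mul, abs_of_nonneg (hψ0 x)]
        refine (mul_le_of_le_one_left (abs_nonneg _) (hψ1 x)).trans ?_
        exact (hχF n _ hxb').trans (le_abs_self _)
      · rw [abs_mul, abs_of_nonneg (hχ0 n _)]
        refine (mul_le_of_le_one_left (abs_nonneg _) (hχ1 n _)).trans ?_
        exact (hBψ x (mem_univ x)).trans (le_abs_self _)
    · rw [dirDeriv_congr (hoff n x hx), dirDeriv_const, abs_zero]
      positivity
  · by_cases hxψ : x ∈ tsupport ψ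
    · obtain ⟨hxs, hxb⟩ := hψN hxψ
      have hxb' : dist (e x) (e x₀) < R / 2 := hxb
      have hmem : e x ∈ Zᶜ := by
        rw [hZdef, compl_compl]
        refine ⟨⟨e.map_source hxs, ?_⟩, ?_⟩
        · rwa [mem_preimage, e.left_inv hxs]
        · rw [Metric.mem_ball]; linarith
      have hpos : 0 < Metric.infDist (e x) Z :=
        (hZ.notMem_iff_infDist_pos hZne).1 hmem
      have hlim : Tendsto (fun n => 4 * δ n) atTop (𝓝 0) := by
        simpa using hδlim.const_mul 4
      filter_upwards [hlim.eventually (gt_mem_nhds hpos)] with n hn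
      have hev : ∀ᶠ z in 𝓝 x, 4 * δ n < Metric.infDist (e z) Z :=
        ((Metric.continuous_infDist_pt Z).continuousAt.comp (e.continuousAt hxs)).eventually
          (lt_mem_nhds hn)
      filter_upwards [hev] with z hz
      rw [hχone n _ hz, mul_one]
    · refine Eventually.of_forall fun n => (hoff n x hxψ).trans ?_
      exact (notMem_tsupport_iff_eventuallyEq.1 hxψ).symm

/-- An open set `Ω` invariant under the flow of `F` has an exhaustion by cutoff functions whose
derivatives along `F` are uniformly bounded. -/
theorem exists_exhaustion (g : Metric M) {F : VField M} (hF : IsC1Field F) {Ω : Set M}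
    (hΩ : IsOpen Ω)
    (hinv : ∀ γ : ℝ → M, IsMIntegralCurve γ F → γ 0 ∉ Ω → ∀ t, γ t ∉ Ω) :
    ∃ (a : ℕ → M → ℝ) (B : ℝ), (∀ n, ContMDiff (𝓡 2) 𝓘(ℝ, ℝ) 1 (a n)) ∧
      (∀ n, tsupport (a n) ⊆ Ω) ∧ (∀ n x, |a n x| ≤ B) ∧
      (∀ n x, |dirDeriv (a n) F x| ≤ B) ∧
      ∀ x ∈ Ω, ∀ᶠ n in atTop, a n =ᶠ[𝓝 x] fun _ => 1 := by
  choose N hN hxN hloc using exists_local_exhaustion g hF hΩ hinv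
  obtain ⟨s, ψ, hψ, hψ0, hψ1, hψN, hsum⟩ := exists_partition_of_unity N hN hxN
  choose a B ha hasupp habd haF hlim using fun i =>
    hloc i (ψ i) ((hψ i).of_le (by norm_num)) (hψ0 i) (hψ1 i) (hψN i)
  -- Each local cutoff is bounded by `1`, so the number of pieces bounds the sum; the maximum serves
  -- both required bounds.
  refine ⟨fun n x => ∑ i ∈ s, a i n x, max s.card (∑ i ∈ s, B i), fun n => ?_, fun n => ?_,
    fun n x => ?_, fun n x => ?_, fun x hx => ?_⟩
  · exact contMDiff_finsetSum fun i _ => ha i n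
  · have hcl : IsClosed (⋃ i ∈ s, tsupport (a i n)) :=
      s.finite_toSet.isClosed_biUnion fun i _ => isClosed_tsupport _
    refine (closure_minimal (fun x hx => ?_) hcl).trans (iUnion₂_subset fun i _ => hasupp i n)
    obtain ⟨i, hi, hne⟩ := Finset.exists_ne_zero_of_sum_ne_zero hx
    exact mem_biUnion (Finset.mem_coe.2 hi) (subset_tsupport _ hne)
  · refine le_max_of_le_left ((Finset.abs_sum_le_sum_abs _ _).trans ?_)
    refine (Finset.sum_le_sum fun i _ => habd i n x).trans ?_
    simp
  · rw [dirDeriv_sum s fun i _ => (ha i n).mdifferentiableAt (by norm_num)]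
    exact le_max_of_le_right ((Finset.abs_sum_le_sum_abs _ _).trans
      (Finset.sum_le_sum fun i _ => haF i n x))
  · have hall : ∀ᶠ n in atTop, ∀ i ∈ s, a i n =ᶠ[𝓝 x] ψ i :=
      (Filter.eventually_all_finset s).2 fun i _ => hlim i x hx
    filter_upwards [hall] with n hn
    filter_upwards [(Filter.eventually_all_finset s).2 hn] with z hz
    rw [Finset.sum_congr rfl hz, hsum]

end Exhaustion

/-! ### Sobolev functions and Green's identity without boundary term. -/

section Sobolev

variable {M : Type*} [TopologicalSpace M] [ChartedSpace Plane M] [IsManifold (𝓡 2) ∞ M]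

theorem inner_self_nonneg (g : Metric M) (x : M) (v : TangentSpace (𝓡 2) x) :
    0 ≤ g.inner x v v := by
  by_cases hv : v = 0
  · rw [hv, map_zero]
  · exact (g.pos x v hv).le

/-- A weak form of Cauchy–Schwarz, from positivity at `v + w` and `v - w`; it suffices for
integrability. -/
theorem abs_inner_le (g : Metric M) (x : M) (v w : TangentSpace (𝓡 2) x) :
    |g.inner x v w| ≤ g.inner x v v + g.inner x w w := by
  have h1 := inner_self_nonneg g x (v + w)
  have h2 := inner_self_nonneg g x (v - w)
  have h3 := inner_self_nonneg g x v
  have h4 := inner_self_nonneg g x w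
  simp only [map_add, map_sub, add_apply, sub_apply, g.symm x w v] at h1 h2
  rw [abs_le]
  constructor <;> linarith

theorem continuousOn_components (c : M) {X : VField M} (hX : IsC1Field X) :
    ContinuousOn (components c X) (chartAt Plane c).source := by
  have := (contMDiffOn_section_iff_components c X (chartAt Plane c).open_source subset_rfl).1
    (ContMDiff.contMDiffOn hX)
  exact this.continuousOn

theorem continuous_inner_grad_self (g : Metric M) {f : M → ℝ}
    (hf : ContMDiff (𝓡 2) 𝓘(ℝ, ℝ) ∞ f) :
    Continuous fun x => g.inner x (grad g f x) (grad g f x) := by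
  have h : (fun x => g.inner x (grad g f x) (grad g f x)) = dirDeriv f (grad g f) := by
    ext x
    exact inner_grad_eq_dirDeriv g f (grad g f) x
  rw [h]
  exact continuous_dirDeriv g (isC1Field_grad g hf) (hf.of_le (by norm_num))

variable [T2Space M] [CompactSpace M] [Nonempty M] [MeasurableSpace M] [BorelSpace M]

omit [T2Space M] in
-- `V` is only measurable chart by chart, so the inner product is written as `∑ g_ij V^i F^j` over a
-- countable chart cover.
theorem aestronglyMeasurable_inner (g : Metric M) {Ω : Set M} {V F : VField M}
    (hV : ∀ c : M, AEStronglyMeasurable (components c V)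
      ((riemannianVolume g).restrict (Ω ∩ (chartAt Plane c).source)))
    (hF : IsC1Field F) :
    AEStronglyMeasurable (fun x => g.inner x (V x) (F x)) ((riemannianVolume g).restrict Ω) := by
  obtain ⟨d, hd⟩ := exists_chart_cover M
  have hΩ : Ω = ⋃ n, Ω ∩ (chartAt Plane (d n)).source := by rw [← inter_iUnion, hd, inter_univ]
  rw [hΩ]
  refine AEStronglyMeasurable.iUnion fun n => ?_
  set c := d n
  have hs : MeasurableSet (chartAt Plane c).source := (chartAt Plane c).open_source.measurableSet
  have hle : (riemannianVolume g).restrict (Ω ∩ (chartAt Plane c).source) ≤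
      (riemannianVolume g).restrict (chartAt Plane c).source :=
    Measure.restrict_mono inter_subset_right le_rfl
  have hFm : ∀ j, AEStronglyMeasurable (fun x => components c F x j)
      ((riemannianVolume g).restrict (Ω ∩ (chartAt Plane c).source)) := fun j =>
    (((EuclideanSpace.proj j : Plane →L[ℝ] ℝ).continuous.comp_continuousOn
      (continuousOn_components c hF)).aestronglyMeasurable hs).mono_measure hle
  have hVm : ∀ i, AEStronglyMeasurable (fun x => components c V x i)
      ((riemannianVolume g).restrict (Ω ∩ (chartAt Plane c).source)) := fun i =>
    (EuclideanSpace.proj i : Plane →L[ℝ] ℝ).continuous.comp_aestronglyMeasurable (hV c)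
  have hGm : ∀ i j, AEStronglyMeasurable (fun x => gram g c (chartAt Plane c x) i j)
      ((riemannianVolume g).restrict (Ω ∩ (chartAt Plane c).source)) := fun i j =>
    (((contDiffOn_gram g c i j).continuousOn.comp (chartAt Plane c).continuousOn
      fun x hx => (chartAt Plane c).map_source hx).aestronglyMeasurable hs).mono_measure hle
  have hsum : AEStronglyMeasurable (fun x => ∑ i, ∑ j, gram g c (chartAt Plane c x) i j *
      (components c V x i * components c F x j))
      ((riemannianVolume g).restrict (Ω ∩ (chartAt Plane c).source)) := by
    simp only [Fin.sum_univ_two]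
    exact (((hGm 0 0).mul ((hVm 0).mul (hFm 0))).add ((hGm 0 1).mul ((hVm 0).mul (hFm 1)))).add
      (((hGm 1 0).mul ((hVm 1).mul (hFm 0))).add ((hGm 1 1).mul ((hVm 1).mul (hFm 1))))
  refine hsum.congr ?_
  have : ∀ᵐ x ∂((riemannianVolume g).restrict (chartAt Plane c).source),
      x ∈ (chartAt Plane c).source := ae_restrict_mem hs
  filter_upwards [hle.absolutelyContinuous.ae_le this] with x hx
  exact (inner_eq_sum g c V F hx).symm

omit [T2Space M] in
theorem integrable_continuous_restrict (g : Metric M) (Ω : Set M) {h : M → ℝ} (hh : Continuous h) :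
    Integrable h ((riemannianVolume g).restrict Ω) :=
  (hh.integrable_of_hasCompactSupport (HasCompactSupport.of_compactSpace h)).restrict

theorem integrable_inner_grad (g : Metric M) {Ω : Set M} {f v : M → ℝ} {V : VField M}
    (hf : ContMDiff (𝓡 2) 𝓘(ℝ, ℝ) ∞ f) (hV : IsSobolev g Ω v V) :
    Integrable (fun x => g.inner x (V x) (grad g f x)) ((riemannianVolume g).restrict Ω) := by
  refine Integrable.mono' (hV.integrable_sq.add
    (integrable_continuous_restrict g Ω (continuous_inner_grad_self g hf)))
    (aestronglyMeasurable_inner g hV.aestronglyMeasurable (isC1Field_grad g hf))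
    (Eventually.of_forall fun x => abs_inner_le g x _ _)

/-- A smooth function belongs to `H¹(Ω)`, its weak gradient being the gradient. -/
theorem isSobolev_of_contMDiff (g : Metric M) (Ω : Set M) {f : M → ℝ}
    (hf : ContMDiff (𝓡 2) 𝓘(ℝ, ℝ) ∞ f) : IsSobolev g Ω f (grad g f) := by
  have hF := isC1Field_grad g hf
  have hf1 : ContMDiff (𝓡 2) 𝓘(ℝ, ℝ) 1 f := hf.of_le (by norm_num)
  refine ⟨?_, fun c => ?_, integrable_continuous_restrict g Ω (continuous_inner_grad_self g hf),
    fun X ⟨hX, K, hKΩ, hK, hXK⟩ => ?_⟩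
  · exact (hf.continuous.memLp_of_hasCompactSupport
      (HasCompactSupport.of_compactSpace f)).restrict Ω
  · exact ((continuousOn_components c hF).aestronglyMeasurable
      (chartAt Plane c).open_source.measurableSet).mono_measure
      (Measure.restrict_mono inter_subset_right le_rfl)
  · have hX' : IsC1Field X := hX
    -- The divergence theorem is used on all of `M` for `f X`; both terms vanish off the support of
    -- `X`, so the integrals restrict to `Ω`.
    have h0 := integral_divergence g (hX'.smul hf1)
    have hdec : ∀ x, divergence g (fun z => f z • X z) x =
        f x * divergence g X x + g.inner x (grad g f x) (X x) := fun x => by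
      rw [inner_grad_eq_dirDeriv]
      exact divergence_smul g hX' (hf1.mdifferentiableAt (by norm_num))
    have hc1 : Continuous fun x => f x * divergence g X x :=
      hf.continuous.mul (continuous_divergence g hX')
    have hc2 : Continuous fun x => g.inner x (grad g f x) (X x) :=
      (continuous_dirDeriv g hX' hf1).congr fun x => (inner_grad_eq_dirDeriv g f X x).symm
    simp only [hdec] at h0
    rw [integral_add (hc1.integrable_of_hasCompactSupport (HasCompactSupport.of_compactSpace _))
      (hc2.integrable_of_hasCompactSupport (HasCompactSupport.of_compactSpace _))] at h0
    rw [setIntegral_eq_integral_of_forall_compl_eq_zero,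
      setIntegral_eq_integral_of_forall_compl_eq_zero]
    · linarith
    · intro x hx
      rw [hXK x fun h => hx (hKΩ h), map_zero]
    · intro x hx
      rw [divergence_eq_zero_of_notMem g hK.isClosed hXK fun h => hx (hKΩ h), mul_zero]

/-- Green's identity on an open set invariant under the gradient flow of `f`: no boundary term
appears, whatever the element `v` of `H¹(Ω)`. -/
theorem setIntegral_inner_grad (g : Metric M) {Ω : Set M} (hΩ : IsOpen Ω) {f v : M → ℝ}
    {V : VField M} (hf : ContMDiff (𝓡 2) 𝓘(ℝ, ℝ) ∞ f)
    (hinv : ∀ γ : ℝ → M, IsMIntegralCurve γ (grad g f) → γ 0 ∉ Ω → ∀ t, γ t ∉ Ω)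
    (hv : IsSobolev g Ω v V) :
    ∫ x in Ω, g.inner x (V x) (grad g f x) ∂(riemannianVolume g) =
      -∫ x in Ω, v x * laplaceBeltrami g f x ∂(riemannianVolume g) := by
  have hF := isC1Field_grad g hf
  obtain ⟨a, B, ha, hasupp, haB, haF, halim⟩ := exists_exhaustion g hF hΩ hinv
  set μ := (riemannianVolume g).restrict Ω
  have had : ∀ n x, MDifferentiableAt (𝓡 2) 𝓘(ℝ, ℝ) (a n) x :=
    fun n x => (ha n).mdifferentiableAt (by norm_num)
  -- Cutting off `∇f` itself gives admissible test fields, and only derivatives of `a n` along `∇f`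
  -- enter their divergence.
  have htest : ∀ n, IsTestField Ω (fun x => a n x • grad g f x) := fun n =>
    ⟨hF.smul (ha n), tsupport (a n), hasupp n, (isClosed_tsupport _).isCompact, fun x hx => by
      simp only
      rw [image_eq_zero_of_notMem_tsupport hx]
      exact zero_smul ℝ (grad g f x)⟩
  have hmemΩ : ∀ᵐ x ∂μ, x ∈ Ω := ae_restrict_mem hΩ.measurableSet
  have hLc : Continuous (laplaceBeltrami g f) := continuous_divergence g hF
  obtain ⟨L, hL⟩ := isCompact_univ.exists_bound_of_continuousOn hLc.continuousOn
  have hdiv : ∀ n x, divergence g (fun z => a n z • grad g f z) x =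
      a n x * laplaceBeltrami g f x + dirDeriv (a n) (grad g f) x :=
    fun n x => divergence_smul g hF (had n x)
  -- The area is finite, so `v ∈ L²` is integrable; a multiple of `|v|` then dominates, by the
  -- uniform bounds on `a n` and its derivative along `∇f`.
  have hvint : Integrable v μ := hv.memLp.integrable (by norm_num)
  have lim1 : Tendsto (fun n => ∫ x, v x * divergence g (fun z => a n z • grad g f z) x ∂μ) atTop
      (𝓝 (∫ x, v x * laplaceBeltrami g f x ∂μ)) := by
    refine tendsto_integral_of_dominated_convergence (fun x => |v x| * (|B| * |L| + |B|))
      (fun n => ?_) (hvint.abs.mul_const _) (fun n => ?_) ?_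
    · exact hvint.aestronglyMeasurable.mul
        (continuous_divergence g (hF.smul (ha n))).aestronglyMeasurable
    · refine Eventually.of_forall fun x => ?_
      rw [Real.norm_eq_abs, abs_mul, hdiv]
      refine mul_le_mul_of_nonneg_left ((abs_add_le _ _).trans (add_le_add ?_ ?_)) (abs_nonneg _)
      · rw [abs_mul]
        exact mul_le_mul ((haB n x).trans (le_abs_self _))
          ((hL x (mem_univ x)).trans (le_abs_self _)) (abs_nonneg _) (abs_nonneg _)
      · exact (haF n x).trans (le_abs_self _)
    · filter_upwards [hmemΩ] with x hx
      refine tendsto_const_nhds.congr' ?_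
      filter_upwards [halim x hx] with n hn
      rw [hdiv, dirDeriv_congr hn, dirDeriv_const, hn.eq_of_nhds, one_mul, add_zero]
  have hint := integrable_inner_grad g hf hv
  have hmul : ∀ n x, g.inner x (V x) (a n x • grad g f x) =
      a n x * g.inner x (V x) (grad g f x) := fun n x => by
    rw [map_smul, smul_eq_mul]
  have lim2 : Tendsto (fun n => ∫ x, g.inner x (V x) (a n x • grad g f x) ∂μ) atTop
      (𝓝 (∫ x, g.inner x (V x) (grad g f x) ∂μ)) := by
    simp only [hmul]
    refine tendsto_integral_of_dominated_convergence
      (fun x => |B| * |g.inner x (V x) (grad g f x)|) (fun n => ?_) (hint.abs.const_mul _)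
      (fun n => ?_) ?_
    · exact (ha n).continuous.aestronglyMeasurable.mul hint.aestronglyMeasurable
    · refine Eventually.of_forall fun x => ?_
      rw [Real.norm_eq_abs, abs_mul]
      exact mul_le_mul_of_nonneg_right ((haB n x).trans (le_abs_self _)) (abs_nonneg _)
    · filter_upwards [hmemΩ] with x hx
      refine tendsto_const_nhds.congr' ?_
      filter_upwards [halim x hx] with n hn
      rw [hn.eq_of_nhds, one_mul]
  have heq : ∀ n, ∫ x, v x * divergence g (fun z => a n z • grad g f z) x ∂μ =
      -∫ x, g.inner x (V x) (a n x • grad g f x) ∂μ := fun n => hv.weak_grad _ (htest n)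
  have h1 := tendsto_nhds_unique (lim1.congr heq) lim2.neg
  rw [h1, neg_neg]

theorem isNeumannEigenfunction_of_invariant (g : Metric M) {Ω : Set M} (hΩ : IsOpen Ω) {f : M → ℝ}
    {lam : ℝ} (heig : IsLaplaceEigenfunction g f lam)
    (hinv : ∀ γ : ℝ → M, IsMIntegralCurve γ (grad g f) → γ 0 ∉ Ω → ∀ t, γ t ∉ Ω)
    (hne : ∃ x ∈ Ω, f x ≠ 0) : IsNeumannEigenfunction g Ω f lam := by
  refine ⟨grad g f, isSobolev_of_contMDiff g Ω heig.smooth, fun hae => ?_, fun v V hv => ?_⟩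
  · obtain ⟨x, hx, hfx⟩ := hne
    have ho : IsOpen (Ω ∩ {z | f z ≠ 0}) :=
      hΩ.inter (isOpen_ne_fun heig.smooth.continuous continuous_const)
    refine ho.measure_ne_zero (riemannianVolume g) ⟨x, hx, hfx⟩ ?_
    rw [ae_restrict_iff' hΩ.measurableSet, ae_iff] at hae
    convert hae using 2
    ext z
    simp
  · have h := setIntegral_inner_grad g hΩ heig.smooth hinv hv
    have hL : ∀ x, laplaceBeltrami g f x = -(lam * f x) := fun x => by
      rw [← heig.eigen x, neg_neg]
    simp only [hL] at h
    simp only [g.symm _ (grad g f _) (V _)]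
    rw [h, ← integral_neg, ← integral_const_mul]
    congr 1
    ext x
    ring

end Sobolev

/-! ### Isolated critical points and openness of stable manifolds. -/

section GradientFlow

variable {M : Type*} [TopologicalSpace M] [ChartedSpace Plane M] [IsManifold (𝓡 2) ∞ M]

theorem mfderiv_eq_zero_iff_fderiv_chart (c : M) {f : M → ℝ} {x : M}
    (hx : x ∈ (chartAt Plane c).source) (hf : MDifferentiableAt (𝓡 2) 𝓘(ℝ, ℝ) f x) :
    mfderiv (𝓡 2) 𝓘(ℝ, ℝ) f x = 0 ↔
      fderiv ℝ (f ∘ (chartAt Plane c).symm) (chartAt Plane c x) = 0 := by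
  constructor
  · intro h
    ext v
    obtain ⟨X, hX⟩ := exists_components_eq c hx v
    have := mfderiv_eq_fderiv_chart c hx hf X
    rw [hX, h] at this
    exact this.symm
  · intro h
    refine ContinuousLinearMap.ext fun v => ?_
    have := mfderiv_eq_fderiv_chart c hx hf fun _ => (v : Plane)
    rw [h] at this
    exact this

theorem mfderiv_eq_zero_of_isLocalMin {f : M → ℝ} {p : M}
    (hf : MDifferentiableAt (𝓡 2) 𝓘(ℝ, ℝ) f p) (hp : IsLocalMin f p) :
    mfderiv (𝓡 2) 𝓘(ℝ, ℝ) f p = 0 := by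
  rw [mfderiv_eq_zero_iff_fderiv_chart p (mem_chart_source Plane p) hf]
  refine IsLocalMin.fderiv_eq_zero ?_
  have hl : (chartAt Plane p).symm (chartAt Plane p p) = p :=
    (chartAt Plane p).left_inv (mem_chart_source Plane p)
  have hc := (chartAt Plane p).continuousAt_symm (mem_chart_target Plane p)
  rw [ContinuousAt, hl] at hc
  have := hc.eventually hp
  filter_upwards [this] with y hy
  simpa [hl] using hy

/-- The derivative of `df` in the chart is the Hessian, injective and hence bounded below in finite
dimension, so `df` cannot return to zero near `p`. -/
theorem eventually_mfderiv_ne_zero {f : M → ℝ} (hf : IsMorse f) {p : M}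
    (hp : mfderiv (𝓡 2) 𝓘(ℝ, ℝ) f p = 0) :
    ∀ᶠ x in 𝓝[≠] p, mfderiv (𝓡 2) 𝓘(ℝ, ℝ) f x ≠ 0 := by
  set e := chartAt Plane p
  have hps : p ∈ e.source := mem_chart_source Plane p
  have hfe : ContDiffOn ℝ ∞ (f ∘ e.symm) e.target :=
    (contMDiffOn_iff_contDiffOn_chart p f le_rfl).1 hf.smooth.contMDiffOn
  have hG : HasFDerivAt (fderiv ℝ (f ∘ e.symm)) (hessian f p) (e p) :=
    (((hfe.contDiffAt (e.open_target.mem_nhds (mem_chart_target Plane p))).fderiv_right (m := 1)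
      (one_add_one_eq_two.trans_le two_le_infty)).differentiableAt (by norm_num)).hasFDerivAt
  have hker : LinearMap.ker (hessian f p : Plane →ₗ[ℝ] (Plane →L[ℝ] ℝ)) = ⊥ := by
    rw [LinearMap.ker_eq_bot']
    intro v hv
    refine hf.nondegenerate p hp v fun w => ?_
    have hv' : hessian f p v = 0 := hv
    rw [hv']
    rfl
  obtain ⟨K, -, hK⟩ := LinearMap.exists_antilipschitzWith _ hker
  have hne := hG.eventually_ne (c := 0) ⟨K, hK⟩
  have htend : Tendsto e (𝓝[≠] p) (𝓝[≠] (e p)) := by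
    refine tendsto_nhdsWithin_of_tendsto_nhds_of_eventually_within _
      ((e.continuousAt hps).tendsto.mono_left nhdsWithin_le_nhds) ?_
    filter_upwards [self_mem_nhdsWithin, mem_nhdsWithin_of_mem_nhds (e.open_source.mem_nhds hps)]
      with x hx hxs heq
    exact hx (e.injOn hxs hps heq)
  filter_upwards [htend.eventually hne, mem_nhdsWithin_of_mem_nhds (e.open_source.mem_nhds hps)]
    with x hx hxs h0
  exact hx ((mfderiv_eq_zero_iff_fderiv_chart p hxs
    (hf.smooth.mdifferentiableAt (by norm_num))).1 h0)

/-- A point of an open set on which `f` vanishes would be a degenerate critical point. This replaces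
unique continuation for eigenfunctions. -/
theorem exists_ne_zero_of_isMorse {f : M → ℝ} (hf : IsMorse f) {U : Set M} (hU : IsOpen U)
    (hne : U.Nonempty) : ∃ x ∈ U, f x ≠ 0 := by
  by_contra! h0
  obtain ⟨y, hy⟩ := hne
  have hev : f =ᶠ[𝓝 y] fun _ => 0 := by
    filter_upwards [hU.mem_nhds hy] with x hx using h0 x hx
  set e := chartAt Plane y
  have hl : e.symm (e y) = y := e.left_inv (mem_chart_source Plane y)
  have hev' : f ∘ e.symm =ᶠ[𝓝 (e y)] fun _ => 0 := by
    have hc := e.continuousAt_symm (mem_chart_target Plane y)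
    rw [ContinuousAt, hl] at hc
    exact hc.eventually hev
  have hd : mfderiv (𝓡 2) 𝓘(ℝ, ℝ) f y = 0 := by
    rw [mfderiv_eq_zero_iff_fderiv_chart y (mem_chart_source Plane y)
      (hf.smooth.mdifferentiableAt (by norm_num)), hev'.fderiv_eq]
    simp
  have hh : hessian f y = 0 := by
    rw [hessian, hev'.fderiv.fderiv_eq]
    simp
  have := hf.nondegenerate y hd (EuclideanSpace.single 0 1) fun w => by rw [hh]; rfl
  simp at this

theorem grad_neg (g : Metric M) {f : M → ℝ} (hf : ContMDiff (𝓡 2) 𝓘(ℝ, ℝ) ∞ f) :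
    grad g (-f) = fun x => -grad g f x := by
  funext x
  have hd : mfderiv (𝓡 2) 𝓘(ℝ, ℝ) (-f) x = -mfderiv (𝓡 2) 𝓘(ℝ, ℝ) f x :=
    ((hf.mdifferentiableAt (by norm_num)).hasMFDerivAt.neg).mfderiv
  by_contra hne
  have hpos := g.pos x (grad g (-f) x - (-grad g f x)) (sub_ne_zero.2 hne)
  refine hpos.ne' ?_
  generalize hw : grad g (-f) x - (-grad g f x) = w at *
  nth_rw 1 [← hw]
  rw [map_sub, map_neg, sub_apply, neg_apply, inner_grad, inner_grad, hd]
  exact sub_self _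

omit [IsManifold (𝓡 2) ∞ M] in
theorem hasDerivAt_comp_integralCurve {F : VField M} {γ : ℝ → M} (hγ : IsMIntegralCurve γ F)
    {u : M → ℝ} {t : ℝ} (hu : MDifferentiableAt (𝓡 2) 𝓘(ℝ, ℝ) u (γ t)) :
    HasDerivAt (u ∘ γ) (dirDeriv u F (γ t)) t := by
  have h := (hu.hasMFDerivAt.comp t (hγ t)).hasFDerivAt
  let l : ℝ →L[ℝ] ℝ := (mfderiv (𝓡 2) 𝓘(ℝ, ℝ) u (γ t)).comp
    ((1 : ℝ →L[ℝ] ℝ).smulRight (F (γ t)))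
  have hl : HasFDerivAt (u ∘ γ) l t := h
  have hval : l 1 = dirDeriv u F (γ t) :=
    congrArg (mfderiv (𝓡 2) 𝓘(ℝ, ℝ) u (γ t)) (one_smul ℝ (F (γ t)))
  rw [← hval]
  exact hl.hasDerivAt

theorem dirDeriv_neg_grad (g : Metric M) (f : M → ℝ) (x : M) :
    dirDeriv f (fun x => -grad g f x) x = -g.inner x (grad g f x) (grad g f x) := by
  rw [inner_grad]
  exact map_neg (mfderiv (𝓡 2) 𝓘(ℝ, ℝ) f x) (grad g f x)

theorem inner_grad_self_pos (g : Metric M) {f : M → ℝ} {x : M}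
    (hx : mfderiv (𝓡 2) 𝓘(ℝ, ℝ) f x ≠ 0) : 0 < g.inner x (grad g f x) (grad g f x) := by
  refine g.pos x _ fun h0 => hx (ContinuousLinearMap.ext fun w => ?_)
  rw [← inner_grad, h0, map_zero]
  rfl

theorem antitone_comp_integralCurve (g : Metric M) {f : M → ℝ}
    (hf : ContMDiff (𝓡 2) 𝓘(ℝ, ℝ) ∞ f) {γ : ℝ → M}
    (hγ : IsMIntegralCurve γ (fun x => -grad g f x : VField M)) : Antitone (f ∘ γ) := by
  refine antitone_of_hasDerivAt_nonpos (f' := fun t => dirDeriv f (fun x => -grad g f x) (γ t))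
    (fun t => hasDerivAt_comp_integralCurve hγ (hf.mdifferentiableAt (by norm_num))) fun t => ?_
  simp only [dirDeriv_neg_grad]
  exact neg_nonpos.2 (inner_self_nonneg g _ _)

omit [IsManifold (𝓡 2) ∞ M] in
theorem isMIntegralCurve_reverse {F : VField M} {γ : ℝ → M} (hγ : IsMIntegralCurve γ F) (t₀ : ℝ) :
    IsMIntegralCurve (fun t => γ (t₀ - t)) (fun x => -F x : VField M) := by
  have h := (hγ.comp_add t₀).comp_mul (-1)
  convert h using 1
  · ext t
    simp only [Function.comp_apply]
    congr 1
    ring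
  · ext x
    simp

theorem isC1Field_neg_grad (g : Metric M) {f : M → ℝ} (hf : ContMDiff (𝓡 2) 𝓘(ℝ, ℝ) ∞ f) :
    IsC1Field (fun x => -grad g f x : VField M) := by
  rw [← grad_neg g hf]
  exact isC1Field_grad g hf.neg

variable [T2Space M] [CompactSpace M]

/-- A local minimum that is an isolated critical point attracts a neighbourhood under the flow of
`-∇f`. -/
theorem exists_trapping_nhds (g : Metric M) {f : M → ℝ} (hf : ContMDiff (𝓡 2) 𝓘(ℝ, ℝ) ∞ f)
    {p : M} (hp : IsLocalMin f p)
    (hiso : ∀ᶠ x in 𝓝[≠] p, mfderiv (𝓡 2) 𝓘(ℝ, ℝ) f x ≠ 0) :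
    ∃ N : Set M, IsOpen N ∧ p ∈ N ∧ ∀ γ : ℝ → M,
      IsMIntegralCurve γ (fun x => -grad g f x : VField M) → γ 0 ∈ N → Tendsto γ atTop (𝓝 p) := by
  have hfd : ∀ x, MDifferentiableAt (𝓡 2) 𝓘(ℝ, ℝ) f x :=
    fun x => hf.mdifferentiableAt (by norm_num)
  rw [eventually_nhdsWithin_iff] at hiso
  obtain ⟨O, hOsub, hO, hpO⟩ := mem_nhds_iff.1 (hp.and hiso)
  have hlt : ∀ x ∈ O, x ≠ p → f p < f x := by
    intro x hx hxp
    -- Equality would make `x` another local minimum, hence a critical point of `f` in `O` other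
    -- than `p`.
    refine lt_of_le_of_ne (hOsub hx).1 fun heq => (hOsub hx).2 hxp ?_
    refine mfderiv_eq_zero_of_isLocalMin (hfd x) ?_
    filter_upwards [hO.mem_nhds hx] with z hz
    rw [← heq]
    exact (hOsub hz).1
  have hgap : ∀ S ⊆ O, IsCompact S → p ∉ S → ∃ m, f p < m ∧ ∀ x ∈ S, m ≤ f x := by
    intro S hSO hS hpS
    rcases S.eq_empty_or_nonempty with rfl | hne
    · exact ⟨f p + 1, by linarith, by simp⟩
    · obtain ⟨x, hx, hmin⟩ := hS.exists_isMinOn hne hf.continuous.continuousOn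
      exact ⟨f x, hlt x (hSO hx) fun h => hpS (h ▸ hx), fun z hz => hmin hz⟩
  obtain ⟨B, hB, hpB, hBO⟩ := exists_compact_subset hO hpO
  -- `m` is a level that `f` reaches or exceeds all along the boundary of `B`. Since `f` decreases
  -- along orbits, one starting below `m` inside `B` cannot cross that boundary.
  obtain ⟨m, hpm, hm⟩ := hgap (B \ interior B) (sdiff_subset.trans hBO)
    (hB.diff isOpen_interior) fun h => h.2 hpB
  refine ⟨interior B ∩ f ⁻¹' Iio m,
    isOpen_interior.inter (isOpen_Iio.preimage hf.continuous), ⟨hpB, hpm⟩, fun γ hγ h0 => ?_⟩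
  have hanti := antitone_comp_integralCurve g hf hγ
  have htrap : ∀ t, 0 ≤ t → γ t ∈ interior B := by
    have hpre : IsPreconnected (γ '' Ici 0) :=
      isPreconnected_Ici.image γ hγ.continuous.continuousOn
    have hsub : γ '' Ici 0 ⊆ interior B := by
      refine hpre.subset_left_of_subset_union isOpen_interior hB.isClosed.isOpen_compl
        (disjoint_compl_right.mono_left interior_subset) ?_ ⟨γ 0, ⟨0, self_mem_Ici, rfl⟩, h0.1⟩
      rintro _ ⟨t, ht, rfl⟩
      by_contra hnot
      rw [mem_union, not_or, notMem_compl_iff] at hnot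
      have h1 : f (γ t) ≤ f (γ 0) := hanti ht
      exact (hm (γ t) ⟨hnot.2, hnot.1⟩).not_gt (h1.trans_lt h0.2)
    exact fun t ht => hsub ⟨t, ht, rfl⟩
  rw [tendsto_nhds]
  intro U hU hpU
  obtain ⟨m', hpm', hm'⟩ := hgap (B \ U) (sdiff_subset.trans hBO) (hB.diff hU) fun h => h.2 hpU
  -- Otherwise the orbit stays in a compact set without critical points, where `|∇f|² ≥ ε > 0`. Then
  -- `f` decreases at rate `ε` and falls below `m'` by time `(f (γ 0) - m' + 1) / ε`.
  obtain ⟨t₁, ht₁, hft₁⟩ : ∃ t, 0 ≤ t ∧ f (γ t) < m' := by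
    by_contra! hnot
    have hScomp : IsCompact (B ∩ f ⁻¹' Ici m') :=
      hB.inter_right (isClosed_Ici.preimage hf.continuous)
    have hγS : ∀ t, 0 ≤ t → γ t ∈ B ∩ f ⁻¹' Ici m' :=
      fun t ht => ⟨interior_subset (htrap t ht), hnot t ht⟩
    obtain ⟨x, hx, hmin⟩ := hScomp.exists_isMinOn ⟨γ 0, hγS 0 le_rfl⟩
      (continuous_inner_grad_self g hf).continuousOn
    have hxp : x ≠ p := by
      rintro rfl
      exact hpm'.not_ge hx.2
    have hpos := inner_grad_self_pos g ((hOsub (hBO hx.1)).2 hxp)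
    set ε := g.inner x (grad g f x) (grad g f x)
    have hder : ∀ t, HasDerivAt (f ∘ γ) (dirDeriv f (fun x => -grad g f x) (γ t)) t :=
      fun t => hasDerivAt_comp_integralCurve hγ (hfd _)
    have hdec : ∀ t, 0 ≤ t → (f ∘ γ) t - (f ∘ γ) 0 ≤ -ε * (t - 0) := by
      intro t ht
      refine (convex_Ici (0 : ℝ)).image_sub_le_mul_sub_of_deriv_le
        (fun s _ => (hder s).continuousAt.continuousWithinAt)
        (fun s _ => (hder s).differentiableAt.differentiableWithinAt) (fun s hs => ?_) 0
        self_mem_Ici t ht ht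
      rw [interior_Ici] at hs
      rw [(hder s).deriv, dirDeriv_neg_grad]
      exact neg_le_neg (hmin (hγS s (le_of_lt hs)))
    have h1 := hdec ((f (γ 0) - m' + 1) / ε) (div_nonneg (by
      have := hnot 0 le_rfl
      linarith) hpos.le)
    have h2 := hnot ((f (γ 0) - m' + 1) / ε) (div_nonneg (by
      have := hnot 0 le_rfl
      linarith) hpos.le)
    rw [sub_zero, neg_mul, mul_div_cancel₀ _ hpos.ne'] at h1
    simp only [Function.comp_apply] at h1
    linarith
  filter_upwards [eventually_ge_atTop t₁] with t ht
  by_contra hnot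
  have h1 : f (γ t) ≤ f (γ t₁) := hanti ht
  exact (hm' (γ t) ⟨interior_subset (htrap t (ht₁.trans ht)), hnot⟩).not_gt (h1.trans_lt hft₁)

/-- An orbit tends to `p` exactly when it enters the trapping neighbourhood at some time, so the
stable manifold is a union of preimages of an open set. -/
theorem isOpen_stableManifold (g : Metric M) {f : M → ℝ} (hf : ContMDiff (𝓡 2) 𝓘(ℝ, ℝ) ∞ f)
    {p : M} (hp : IsLocalMin f p)
    (hiso : ∀ᶠ x in 𝓝[≠] p, mfderiv (𝓡 2) 𝓘(ℝ, ℝ) f x ≠ 0) :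
    IsOpen (stableManifold g f p) := by
  have hF := isC1Field_neg_grad g hf
  obtain ⟨N, hN, hpN, htrap⟩ := exists_trapping_nhds g hf hp hiso
  obtain ⟨φ, hφ0, hφ, hφadd, hφc⟩ := exists_flow hF
  have : stableManifold g f p = ⋃ T, φ T ⁻¹' N := by
    ext y
    simp only [mem_iUnion, mem_preimage]
    constructor
    · rintro ⟨γ, ⟨hγ0, hγ⟩, hlim⟩
      have heq : γ = fun t => φ t y :=
        IsMIntegralCurve.eq_of_isC1Field hF hγ (hφ y) (t := 0) (by rw [hγ0, hφ0])
      obtain ⟨T, hT⟩ := (hlim.eventually (hN.mem_nhds hpN)).exists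
      exact ⟨T, by rwa [heq] at hT⟩
    · rintro ⟨T, hT⟩
      refine ⟨fun t => φ t y, ⟨hφ0 y, hφ y⟩, ?_⟩
      have h1 := htrap _ (hφ (φ T y)) (by rwa [hφ0])
      simp only [← hφadd] at h1
      refine (h1.comp (tendsto_atTop_add_const_right atTop (-T) tendsto_id)).congr fun t => ?_
      simp
  rw [this]
  exact isOpen_iUnion fun T => hN.preimage (hφc T)

end GradientFlow

/-! ### Openness and invariance of Neumann domains; the normal derivative. -/

section NeumannDomain

variable {M : Type*} [TopologicalSpace M] [ChartedSpace Plane M] [IsManifold (𝓡 2) ∞ M]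

/-- Time reversal turns the flow of `-∇f` into that of `∇f`, so local maxima reduce to local minima
of `-f`. -/
theorem unstableManifold_eq (g : Metric M) {f : M → ℝ} (hf : ContMDiff (𝓡 2) 𝓘(ℝ, ℝ) ∞ f)
    (q : M) : unstableManifold g f q = stableManifold g (-f) q := by
  ext y
  constructor
  · rintro ⟨γ, ⟨h0, hγ⟩, hlim⟩
    refine ⟨fun t => γ (0 - t), ⟨by simpa using h0, ?_⟩, ?_⟩
    · convert isMIntegralCurve_reverse hγ 0 using 1
      rw [grad_neg g hf]
    · simpa using hlim
  · rintro ⟨γ, ⟨h0, hγ⟩, hlim⟩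
    refine ⟨fun t => γ (0 - t), ⟨by simpa using h0, ?_⟩, ?_⟩
    · convert isMIntegralCurve_reverse hγ 0 using 1
      rw [grad_neg g hf]
      simp
    · simpa using hlim

variable [T2Space M] [CompactSpace M]

theorem isOpen_inter_stable_unstable (g : Metric M) {f : M → ℝ} (hf : IsMorse f) {p q : M}
    (hp : IsLocalMin f p) (hq : IsLocalMax f q) :
    IsOpen (stableManifold g f p ∩ unstableManifold g f q) := by
  have hfd : ∀ x, MDifferentiableAt (𝓡 2) 𝓘(ℝ, ℝ) f x :=
    fun x => hf.smooth.mdifferentiableAt (by norm_num)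
  have hneg : ∀ x, mfderiv (𝓡 2) 𝓘(ℝ, ℝ) (-f) x = -mfderiv (𝓡 2) 𝓘(ℝ, ℝ) f x :=
    fun x => ((hfd x).hasMFDerivAt.neg).mfderiv
  have hq' : IsLocalMin (-f) q := hq.neg
  have hq0 : mfderiv (𝓡 2) 𝓘(ℝ, ℝ) f q = 0 := by
    have h1 := mfderiv_eq_zero_of_isLocalMin (hfd q).neg hq'
    rw [hneg] at h1
    exact neg_eq_zero.1 h1
  refine (isOpen_stableManifold g hf.smooth hp (eventually_mfderiv_ne_zero hf
    (mfderiv_eq_zero_of_isLocalMin (hfd p) hp))).inter ?_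
  rw [unstableManifold_eq g hf.smooth]
  refine isOpen_stableManifold g (f := -f) hf.smooth.neg hq' ?_
  filter_upwards [eventually_mfderiv_ne_zero hf hq0] with x hx h0
  rw [hneg] at h0
  exact hx (neg_eq_zero.1 h0)

theorem IsNeumannDomain.isOpen {g : Metric M} {f : M → ℝ} (hf : IsMorse f) {Ω : Set M}
    (hΩ : IsNeumannDomain g f Ω) : IsOpen Ω := by
  obtain ⟨p, q, hp, hq, y, hy, rfl⟩ := hΩ
  have : LocallyConnectedSpace M := ChartedSpace.locallyConnectedSpace Plane M
  exact (isOpen_inter_stable_unstable g hf hp hq).connectedComponentIn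

omit [T2Space M] [CompactSpace M] in
theorem IsNeumannDomain.nonempty {g : Metric M} {f : M → ℝ} {Ω : Set M}
    (hΩ : IsNeumannDomain g f Ω) : Ω.Nonempty := by
  obtain ⟨p, q, hp, hq, y, hy, rfl⟩ := hΩ
  exact ⟨y, mem_connectedComponentIn hy⟩

omit [CompactSpace M] in
/-- A Neumann domain is invariant under the flow of `-∇f`. -/
theorem IsNeumannDomain.mem_of_integralCurve {g : Metric M} {f : M → ℝ}
    (hf : ContMDiff (𝓡 2) 𝓘(ℝ, ℝ) ∞ f) {Ω : Set M} (hΩ : IsNeumannDomain g f Ω) {γ : ℝ → M}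
    (hγ : IsMIntegralCurve γ (fun x => -grad g f x : VField M)) {s : ℝ} (hs : γ s ∈ Ω) (t : ℝ) :
    γ t ∈ Ω := by
  have hF := isC1Field_neg_grad g hf
  obtain ⟨p, q, hp, hq, y, hy, rfl⟩ := hΩ
  obtain ⟨⟨γ₁, ⟨h10, h1⟩, hlim1⟩, ⟨γ₂, ⟨h20, h2⟩, hlim2⟩⟩ := connectedComponentIn_subset _ _ hs
  have hγs : IsMIntegralCurve (γ ∘ (· + s)) (fun x => -grad g f x : VField M) := hγ.comp_add s
  have e1 : γ₁ = γ ∘ (· + s) := IsMIntegralCurve.eq_of_isC1Field hF h1 hγs (t := 0) (by simp [h10])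
  have e2 : γ₂ = γ ∘ (· + s) := IsMIntegralCurve.eq_of_isC1Field hF h2 hγs (t := 0) (by simp [h20])
  -- A time shift changes neither limit, so the whole orbit lies in the intersection; being
  -- connected, it stays in one component.
  have hsub : range γ ⊆ stableManifold g f p ∩ unstableManifold g f q := by
    rintro _ ⟨r, rfl⟩
    refine ⟨⟨γ ∘ (· + r), ⟨by simp, hγ.comp_add r⟩, ?_⟩, ⟨γ ∘ (· + r), ⟨by simp, hγ.comp_add r⟩, ?_⟩⟩
    · rw [e1] at hlim1
      have := hlim1.comp (tendsto_atTop_add_const_right atTop (r - s) tendsto_id)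
      refine this.congr fun t => ?_
      simp [add_assoc]
    · rw [e2] at hlim2
      have := hlim2.comp (tendsto_atBot_add_const_right atBot (r - s) tendsto_id)
      refine this.congr fun t => ?_
      simp [add_assoc]
  rw [connectedComponentIn_eq hs]
  exact (isPreconnected_range hγ.continuous).subset_connectedComponentIn ⟨s, rfl⟩ hsub ⟨t, rfl⟩

theorem IsNeumannDomain.notMem_of_integralCurve_grad {g : Metric M} {f : M → ℝ}
    (hf : ContMDiff (𝓡 2) 𝓘(ℝ, ℝ) ∞ f) {Ω : Set M} (hΩ : IsNeumannDomain g f Ω) (γ : ℝ → M)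
    (hγ : IsMIntegralCurve γ (grad g f)) (h0 : γ 0 ∉ Ω) (t : ℝ) : γ t ∉ Ω := by
  intro ht
  have h := hΩ.mem_of_integralCurve hf (isMIntegralCurve_reverse hγ t) (s := 0) (by simpa using ht) t
  exact h0 (by simpa using h)

/-- Flow maps preserve both the closure of `Ω` and its complement, so the orbit of a frontier point
stays in the frontier. Thus `h` is zero along it near time zero, and the chain rule needs
differentiability of `h` only at `x`. -/
theorem IsNeumannDomain.normalDerivativeVanishes {g : Metric M} {f : M → ℝ} (hf : IsMorse f)
    {Ω : Set M} (hΩ : IsNeumannDomain g f Ω) : NormalDerivativeVanishes g Ω f := by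
  intro x hx h hh hh0
  obtain ⟨φ, hφ0, hφ, hφadd, hφc⟩ := exists_flow (isC1Field_neg_grad g hf.smooth)
  have hΩo := hΩ.isOpen hf
  have hinv : ∀ t, ∀ y ∈ Ω, φ t y ∈ Ω := fun t y hy =>
    hΩ.mem_of_integralCurve hf.smooth (hφ y) (s := 0) (by simpa [hφ0] using hy) t
  have hfr : ∀ t, φ t x ∈ frontier Ω := by
    intro t
    rw [hΩo.frontier_eq] at hx ⊢
    refine ⟨map_mem_closure (hφc t) hx.1 (hinv t), fun hmem => hx.2 ?_⟩
    have := hinv (-t) _ hmem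
    rwa [← hφadd, neg_add_cancel, hφ0] at this
  have hhx : MDifferentiableAt (𝓡 2) 𝓘(ℝ, ℝ) h (φ 0 x) := by rwa [hφ0]
  have hder := hasDerivAt_comp_integralCurve (hφ x) (t := 0) hhx
  have hcont : Tendsto (fun t => φ t x) (𝓝 0) (𝓝[frontier Ω] x) := by
    refine tendsto_nhdsWithin_iff.2 ⟨?_, Eventually.of_forall hfr⟩
    have := (hφ x).continuous.tendsto 0
    rwa [hφ0] at this
  have hev : h ∘ (fun t => φ t x) =ᶠ[𝓝 0] fun _ => 0 := hcont.eventually hh0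
  have hzero := (hder.congr_of_eventuallyEq hev.symm).unique (hasDerivAt_const (0 : ℝ) (0 : ℝ))
  simp only [hφ0] at hzero
  rw [inner_grad]
  have hneg : dirDeriv h (fun x => -grad g f x) x =
      -(mfderiv (𝓡 2) 𝓘(ℝ, ℝ) h x (grad g f x) : ℝ) :=
    map_neg (mfderiv (𝓡 2) 𝓘(ℝ, ℝ) h x) (grad g f x)
  rw [hneg] at hzero
  exact neg_eq_zero.1 hzero

end NeumannDomain

end NeumannDomains

open NeumannDomains in
theorem mainTheorem7 {M : Type*} [TopologicalSpace M] [ChartedSpace Plane M]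
    [IsManifold (𝓡 2) ∞ M] [T2Space M] [CompactSpace M] [ConnectedSpace M]
    [MeasurableSpace M] [BorelSpace M]
    (g : Metric M) (f : M → ℝ) (lam : ℝ)
    (hf : IsMorse f) (heig : IsLaplaceEigenfunction g f lam)
    (Ω : Set M) (hΩ : IsNeumannDomain g f Ω) :
    IsNeumannEigenfunction g Ω f lam ∧ NormalDerivativeVanishes g Ω f :=
  ⟨isNeumannEigenfunction_of_invariant g (hΩ.isOpen hf) heig
    (hΩ.notMem_of_integralCurve_grad hf.smooth)
    (exists_ne_zero_of_isMorse hf (hΩ.isOpen hf) hΩ.nonempty), hΩ.normalDerivativeVanishes hf⟩
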